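/- Theorem. Let $n\ge 1$ and let $\mathrm{IP}_n(x,y)=\sum_{i=1}^n x_iy_i \bmod 2$ for $x,y\in\{0,1\}^n$. Consider two-party quantum protocols without pre-shared entanglement: the qubits start in the state $|x\rangle_A|\vec 0\rangle_{A_0}|y\rangle_B|\vec 0\rangle_{B_0}|z\rangle_{\mathrm{ans}}$, where Alice holds her input register $A$ and finitely many ancilla qubits $A_0$, and Bob holds his input register $B$, finitely many ancilla qubits $B_0$ and the one-qubit answer register. The players take turns, either of them acting first; in each turn a player applies a unitary to the qubits in their possession and then sends a (possibly empty) subset of them to the other player. The protocol computes $f:\{0,1\}^n\times\{0,1\}^n\to\{0,1\}$ exactly and cleanly if, for all $x,y\in\{0,1\}^n$ and $z\in\{0,1\}$, the final state is $|x\rangle_A|\vec 0\rangle_{A_0}|y\rangle_B|\vec 0\rangle_{B_0}|z\oplus f(x,y)\rangle_{\mathrm{ans}}$, with $A$ held by Alice and with $B$ and the answer register held by Bob (an ancilla qubit may end up with either player). Let $Q_{\mathrm{clean}}(f)$ be the minimum total number of qubits sent, over all such protocols with any numbers of ancilla qubits. Then $$n+1\;\le\; Q_{\mathrm{clean}}(\mathrm{IP}_n)\;\le\;\begin{cases}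 n+3 & \text{for } n \text{ odd},\\ n+2 & \text{for } n \text{ even}.\end{cases}$$ Moreover, no ancilla qubits are required for the upper bounds: there is a protocol without any ancilla qubits that exactly and cleanly computes $\mathrm{IP}_n$ by sending at most $n+3$ qubits for $n$ odd and at most $n+2$ qubits for $n$ even. -/

import Mathlib

namespace CleanComm

/-- Values of a (qu)bit in the computational basis; addition is addition modulo 2. -/
abbrev Bit : Type := ZMod 2

/-- The two players. -/
inductive Player : Type
  | alice
  | bob
  deriving DecidableEq

/-- The other player. -/
def Player.other : Player → Player
  | .alice => .bob
  | .bob => .alice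

/-- (Unnormalised) pure states of the qubits labelled by `ι`, as amplitude functions on the
computational basis `ι → Bit`. -/
abbrev State (ι : Type) : Type := (ι → Bit) → ℂ

/-- The computational basis state `|w⟩`. -/
def ket {ι : Type} [Fintype ι] [DecidableEq ι] (w : ι → Bit) : State ι := Pi.single w 1

/-- The labels of the qubits that player `p` possesses. -/
abbrev Held {ι : Type} (owner : ι → Player) (p : Player) : Type := {i : ι // owner i = p}

/-- The basis string that agrees with `v` on the qubits of player `p` and with `w` elsewhere. -/
def overwrite {ι : Type} (owner : ι → Player) (p : Player)
    (w : ι → Bit) (v : Held owner p → Bit) : ι → Bit :=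
  fun i => if h : owner i = p then v ⟨i, h⟩ else w i

/-- The operator `U ⊗ 1`, where `U` acts on the qubits in the possession of player `p` and the
identity acts on all other qubits. -/
def applyLocal {ι : Type} [Fintype ι] [DecidableEq ι] (owner : ι → Player) (p : Player)
    (U : Matrix (Held owner p → Bit) (Held owner p → Bit) ℂ) (ψ : State ι) : State ι :=
  fun w => ∑ v : Held owner p → Bit, U (fun i => w i) v * ψ (overwrite owner p w v)

/-- Possession of the qubits after player `p` has sent the qubits in `S` to the other player. -/
def transfer {ι : Type} [DecidableEq ι] (owner : ι → Player) (p : Player) (S : Finset ι) :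
    ι → Player :=
  fun i => if i ∈ S then p.other else owner i

/-- `Turns p owner` is the type of finite sequences of alternating turns in which player `p` is
the next one to act and `owner` is the current possession of the qubits. In a turn, the acting
player applies a unitary to all the qubits in their possession and then sends a (possibly empty)
subset of these qubits to the other player. -/
inductive Turns {ι : Type} [Fintype ι] [DecidableEq ι] : Player → (ι → Player) → Type
  | done (p : Player) (owner : ι → Player) : Turns p owner
  | turn (p : Player) (owner : ι → Player)
      (U : Matrix.unitaryGroup (Held owner p → Bit) ℂ)
      (S : Finset ι) (hS : ∀ i ∈ S, owner i = p)
      (rest : Turns p.other (transfer owner p S)) : Turns p owner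

namespace Turns

variable {ι : Type} [Fintype ι] [DecidableEq ι]

/-- The total number of qubits sent, in both directions. -/
def cost : {p : Player} → {owner : ι → Player} → Turns p owner → ℕ
  | _, _, .done _ _ => 0
  | _, _, .turn _ _ _ S _ rest => S.card + rest.cost

/-- The possession of the qubits after all turns. -/
def finalOwner : {p : Player} → {owner : ι → Player} → Turns p owner → ι → Player
  | _, owner, .done _ _ => owner
  | _, _, .turn _ _ _ _ _ rest => rest.finalOwner

/-- The state after all turns, as a function of the state before them. -/
def run : {p : Player} → {owner : ι → Player} → Turns p owner → State ι → State ι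
  | _, _, .done _ _, ψ => ψ
  | _, _, .turn p owner U _ _ rest, ψ => rest.run (applyLocal owner p U.1 ψ)

end Turns

/-- The qubits of a protocol on `n`-bit inputs with `a` ancilla qubits for Alice and `b` for Bob:
Alice's input and ancillas, then Bob's input and ancillas, then the answer register. -/
abbrev Qubits (n a b : ℕ) : Type := ((Fin n ⊕ Fin a) ⊕ (Fin n ⊕ Fin b)) ⊕ Unit

/-- Initially Alice holds her input and ancillas, Bob holds his input and ancillas and the answer
register. -/
def initialOwner (n a b : ℕ) : Qubits n a b → Player
  | .inl (.inl _) => .alice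
  | .inl (.inr _) => .bob
  | .inr _ => .bob

/-- The basis string of `|x⟩_A |0⟩_{A₀} |y⟩_B |0⟩_{B₀} |z⟩_{ans}`. -/
def config {n a b : ℕ} (x y : Fin n → Bit) (z : Bit) : Qubits n a b → Bit
  | .inl (.inl (.inl i)) => x i
  | .inl (.inl (.inr _)) => 0
  | .inl (.inr (.inl i)) => y i
  | .inl (.inr (.inr _)) => 0
  | .inr _ => z

/-- A two-party quantum protocol without pre-shared entanglement; either player may start. -/
structure Protocol (n a b : ℕ) where
  /-- The player who acts first. -/
  first : Player
  /-- The turns of the protocol. -/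
  turns : Turns first (initialOwner n a b)

/-- The number of qubits exchanged by a protocol. -/
def Protocol.cost {n a b : ℕ} (P : Protocol n a b) : ℕ := P.turns.cost

/-- The protocol exactly and cleanly computes `f`: on all inputs it adds `f x y` to the answer
register and returns all other registers to their initial states, and at the end each player holds
their own input register and Bob holds the answer register. (An ancilla qubit, which is back in
state `|0⟩`, may end up with either player.) -/
structure Protocol.ComputesCleanly {n a b : ℕ} (P : Protocol n a b)
    (f : (Fin n → Bit) → (Fin n → Bit) → Bit) : Prop where
  run_eq : ∀ (x y : Fin n → Bit) (z : Bit),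
    P.turns.run (ket (config x y z)) = ket (config x y (z + f x y))
  alice_input : ∀ i : Fin n, P.turns.finalOwner (.inl (.inl (.inl i))) = .alice
  bob_input : ∀ i : Fin n, P.turns.finalOwner (.inl (.inr (.inl i))) = .bob
  answer : P.turns.finalOwner (.inr ()) = .bob

/-- The clean quantum communication complexity of exactly computing `f` without pre-shared
entanglement: the least number of qubits exchanged by a protocol, with any finite numbers of
ancilla qubits, that cleanly computes `f` (`⊤` if there is none). -/
noncomputable def Qclean {n : ℕ} (f : (Fin n → Bit) → (Fin n → Bit) → Bit) : ℕ∞ :=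
  ⨅ (a : ℕ) (b : ℕ) (P : Protocol n a b) (_ : P.ComputesCleanly f), (P.cost : ℕ∞)

/-- The Inner Product function on `n`-bit strings. -/
def IP (n : ℕ) (x y : Fin n → Bit) : Bit := ∑ i, x i * y i

end CleanComm

set_option linter.unusedSectionVars false

/-! Lower bound. With the answer register in |-⟩, a clean protocol for IP is a phase query. If
Alice's register is in uniform superposition, one run turns it into the Hadamard transform of `y`,
so Alice learns all `n` bits of `y`; symmetrically, on another input state, the same protocol tells
Bob all of `x`. Cleanliness matters because leftover garbage would spoil the interference. A
received qubit multiplies the total success probability of guessing by at most 4 (`Bounded.insert`),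
that is, it carries at most two bits. The very first qubit sent reaches a receiver not yet entangled
with anything, and only gains a factor 2 (`Fresh.insert`). Hence 2n is at most twice the cost minus
one (`Turns.gain_add_gain`), which by parity forces cost at least n + 1.

Upper bound. Alice's first qubit makes round trips while Alice applies Paulis given by two bits of
`x` per round and Bob Paulis given by two bits of `y` times the answer bit. Commuting these past
each other yields the phase z·IP(x, y) two terms at a time (`Realizes.rounds`). One extra round
cancels the accumulated Paulis, except for a Z of Bob that supplies the term of the travelling bit
itself (`realizes_phaseIP`). Hadamards on the answer register turn the phase into an addition. -/

namespace CleanComm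
open Matrix

/-! ### Operators local to a set of qubits. -/

section Local
variable {ι : Type}

variable {owner : ι → Player} {p : Player}

/-- The operator `E` acts as the identity on all qubits outside `T`. -/
def IsLocal (T : Set ι) (E : Matrix (ι → Bit) (ι → Bit) ℂ) : Prop :=
  (∀ w w', E w w' ≠ 0 → ∀ i, i ∉ T → w i = w' i) ∧
  (∀ w w' t : ι → Bit, (∀ i ∈ T, t i = 0) → E (w + t) (w' + t) = E w w')

theorem IsLocal.mono {S T : Set ι} (h : S ⊆ T) {E : Matrix (ι → Bit) (ι → Bit) ℂ}
    (hE : IsLocal S E) : IsLocal T E :=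
  ⟨fun w w' hw i hi => hE.1 w w' hw i (fun h' => hi (h h')),
   fun w w' t ht => hE.2 w w' t fun i hi => ht i (h hi)⟩

theorem IsLocal.conjTranspose {T : Set ι} {E : Matrix (ι → Bit) (ι → Bit) ℂ}
    (hE : IsLocal T E) : IsLocal T Eᴴ := by
  refine ⟨fun w w' hw i hi => ?_, fun w w' t ht => ?_⟩
  · rw [conjTranspose_apply, ne_eq, star_eq_zero] at hw
    exact (hE.1 _ _ hw i hi).symm
  · rw [conjTranspose_apply, conjTranspose_apply, hE.2 _ _ t ht]

theorem overwrite_held (w : ι → Bit) (v : Held owner p → Bit) :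
    (fun i : Held owner p => overwrite owner p w v i) = v := by
  funext i
  simp [overwrite, i.2]

theorem overwrite_of_ne (w : ι → Bit) (v : Held owner p → Bit) {i : ι} (hi : owner i ≠ p) :
    overwrite owner p w v i = w i := by
  simp [overwrite, hi]

theorem overwrite_self {w w' : ι → Bit} (h : ∀ i, owner i ≠ p → w i = w' i) :
    overwrite owner p w (fun i => w' i) = w' := by
  funext i
  by_cases hi : owner i = p
  · simp [overwrite, hi]
  · rw [overwrite_of_ne _ _ hi, h i hi]

theorem overwrite_injective (w : ι → Bit) : Function.Injective (overwrite owner p w) :=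
  fun v v' h => by rw [← overwrite_held w v, h, overwrite_held]

variable [Fintype ι]

theorem isLocal_one (T : Set ι) : IsLocal T (1 : Matrix (ι → Bit) (ι → Bit) ℂ) := by
  refine ⟨fun w w' hw i _ => ?_, fun w w' t _ => ?_⟩
  · by_cases h : w = w'
    · rw [h]
    · exact absurd (one_apply_ne h) hw
  · simp [one_apply]

/-- The operator `U ⊗ 1` as a matrix on all qubits. -/
def extend (owner : ι → Player) (p : Player)
    (U : Matrix (Held owner p → Bit) (Held owner p → Bit) ℂ) :
    Matrix (ι → Bit) (ι → Bit) ℂ :=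
  Matrix.of fun w w' =>
    if ∀ i, owner i ≠ p → w i = w' i then U (fun i => w i) (fun i => w' i) else 0

/-- The qubits in the possession of `p`. -/
def holdings (owner : ι → Player) (p : Player) : Set ι := {i | owner i = p}

theorem extend_apply (U : Matrix (Held owner p → Bit) (Held owner p → Bit) ℂ) (w w' : ι → Bit) :
    extend owner p U w w' =
      if ∀ i, owner i ≠ p → w i = w' i then U (fun i => w i) (fun i => w' i) else 0 := rfl

theorem isLocal_extend (U : Matrix (Held owner p → Bit) (Held owner p → Bit) ℂ) :
    IsLocal (holdings owner p) (extend owner p U) := by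
  refine ⟨fun w w' hw i hi => ?_, fun w w' t ht => ?_⟩
  · by_contra h
    exact hw (if_neg fun h' => h (h' i hi))
  · have : ∀ w : ι → Bit, (fun i : Held owner p => (w + t) i) = fun i : Held owner p => w i := by
      intro w
      funext i
      simp [ht i i.2]
    rw [extend_apply, extend_apply, this, this]
    simp only [Pi.add_apply, add_left_inj]

theorem extend_one : extend owner p 1 = 1 := by
  ext w u
  by_cases h : ∀ i, owner i ≠ p → w i = u i
  · rw [extend_apply, if_pos h, one_apply, one_apply]
    refine if_congr ⟨fun h' => ?_, fun h' => by rw [h']⟩ rfl rfl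
    funext i
    by_cases hi : owner i = p
    · exact congrFun h' ⟨i, hi⟩
    · exact h i hi
  · rw [extend_apply, if_neg h, one_apply_ne]
    exact fun h' => h fun i _ => congrFun h' i

theorem extend_conjTranspose (U : Matrix (Held owner p → Bit) (Held owner p → Bit) ℂ) :
    (extend owner p U)ᴴ = extend owner p Uᴴ := by
  ext w u
  simp only [conjTranspose_apply, extend_apply, apply_ite star, star_zero]
  exact if_congr ⟨fun h i hi => (h i hi).symm, fun h i hi => (h i hi).symm⟩ rfl rfl

theorem extend_injective : Function.Injective (extend owner p) := by
  intro U V h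
  ext u v
  have := congrFun (congrFun h (overwrite owner p 0 u)) (overwrite owner p 0 v)
  rw [extend_apply, extend_apply, if_pos, if_pos, overwrite_held, overwrite_held] at this
  · exact this
  all_goals
    intro i hi
    rw [overwrite_of_ne _ _ hi, overwrite_of_ne _ _ hi]

variable [DecidableEq ι]

theorem IsLocal.mul {T : Set ι} {E F : Matrix (ι → Bit) (ι → Bit) ℂ}
    (hE : IsLocal T E) (hF : IsLocal T F) : IsLocal T (E * F) := by
  refine ⟨fun w w' hw i hi => ?_, fun w w' t ht => ?_⟩
  · rw [mul_apply] at hw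
    obtain ⟨v, -, hv⟩ := Finset.exists_ne_zero_of_sum_ne_zero hw
    exact (hE.1 _ _ (left_ne_zero_of_mul hv) i hi).trans (hF.1 _ _ (right_ne_zero_of_mul hv) i hi)
  · rw [mul_apply, mul_apply]
    refine (Fintype.sum_equiv (Equiv.addRight t) _ _ fun v => ?_).symm
    rw [Equiv.coe_addRight, hE.2 _ _ t ht, hF.2 _ _ t ht]

/-- Operators on disjoint sets of qubits commute. -/
theorem IsLocal.commute {S T : Set ι} (hST : Disjoint S T)
    {E F : Matrix (ι → Bit) (ι → Bit) ℂ} (hE : IsLocal S E) (hF : IsLocal T F) :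
    E * F = F * E := by
  -- If `w`, `v` differ only in `S` and `v`, `u` only in `T`, then `w + u - v` is the opposite
  -- corner of the rectangle: both routes from `w` to `u` have the same amplitude.
  have key : ∀ {S T : Set ι} (_ : Disjoint S T) {E F : Matrix (ι → Bit) (ι → Bit) ℂ}
      (_ : IsLocal S E) (_ : IsLocal T F) (w v u : ι → Bit), E w v ≠ 0 → F v u ≠ 0 →
      E w v * F v u = F w (w + u - v) * E (w + u - v) u := by
    intro S T hST E F hE hF w v u h1 h2
    have e1 := hF.2 v u (w - v) fun i hi => by
      simp [hE.1 _ _ h1 i (fun h => hST.le_bot ⟨h, hi⟩)]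
    have e2 := hE.2 w v (u - v) fun i hi => by
      simp [hF.1 _ _ h2 i (fun h => hST.le_bot ⟨hi, h⟩)]
    rw [← e1, ← e2, mul_comm]
    congr 2 <;> abel
  ext w u
  rw [mul_apply, mul_apply]
  refine Fintype.sum_equiv (Equiv.subLeft (w + u)) _ _ fun v => ?_
  rw [Equiv.subLeft_apply]
  by_cases h : E w v * F v u = 0
  · rw [h]
    by_contra h'
    have h'' := Ne.symm h'
    have := key hST.symm hF hE w (w + u - v) u (left_ne_zero_of_mul h'') (right_ne_zero_of_mul h'')
    rw [this] at h''
    simp only [sub_sub_cancel] at h''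
    exact h'' h
  · exact key hST hE hF w v u (left_ne_zero_of_mul h) (right_ne_zero_of_mul h)

/-- A sum over all strings of a function supported on those that agree with `w` outside the
holdings of `p`. -/
theorem sum_overwrite (w : ι → Bit) (f : (ι → Bit) → ℂ)
    (hf : ∀ w', f w' ≠ 0 → ∀ i, owner i ≠ p → w i = w' i) :
    ∑ v, f (overwrite owner p w v) = ∑ w', f w' := by
  refine Fintype.sum_of_injective _ (overwrite_injective w) _ _ (fun w' hw' => ?_) fun _ => rfl
  by_contra h
  exact hw' ⟨_, overwrite_self (hf w' h)⟩

theorem applyLocal_eq (U : Matrix (Held owner p → Bit) (Held owner p → Bit) ℂ) (ψ : State ι) :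
    applyLocal owner p U ψ = extend owner p U *ᵥ ψ := by
  funext w
  rw [mulVec, dotProduct, ← sum_overwrite (owner := owner) (p := p) w, applyLocal]
  · refine Finset.sum_congr rfl fun v _ => ?_
    rw [extend_apply, if_pos fun i hi => (overwrite_of_ne w v hi).symm, overwrite_held]
  · intro w' h
    exact fun i hi => (isLocal_extend U).1 w w' (left_ne_zero_of_mul h) i hi

theorem extend_mul (U V : Matrix (Held owner p → Bit) (Held owner p → Bit) ℂ) :
    extend owner p U * extend owner p V = extend owner p (U * V) := by
  ext w u
  rw [mul_apply, ← sum_overwrite (owner := owner) (p := p) w]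
  · by_cases h : ∀ i, owner i ≠ p → w i = u i
    · rw [extend_apply (U * V), if_pos h, mul_apply]
      refine Finset.sum_congr rfl fun v _ => ?_
      rw [extend_apply, if_pos fun i hi => (overwrite_of_ne w v hi).symm, extend_apply,
        if_pos fun i hi => (overwrite_of_ne w v hi).trans (h i hi), overwrite_held]
    · rw [extend_apply (U * V), if_neg h]
      refine Finset.sum_eq_zero fun v _ => ?_
      rw [extend_apply V, if_neg (fun h' => h fun i hi => ?_), mul_zero]
      rw [← h' i hi, overwrite_of_ne w v hi]
  · intro w' h
    exact fun i hi => (isLocal_extend U).1 w w' (left_ne_zero_of_mul h) i hi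

theorem extend_unitary (U : unitaryGroup (Held owner p → Bit) ℂ) :
    (extend owner p U.1)ᴴ * extend owner p U.1 = 1 := by
  rw [extend_conjTranspose, extend_mul, ← star_eq_conjTranspose,
    mem_unitaryGroup_iff'.1 U.2, extend_one]

/-- A unitary that is local to the holdings of `p` can be applied by `p`. -/
theorem exists_extend_eq {G : Matrix (ι → Bit) (ι → Bit) ℂ}
    (hG : IsLocal (holdings owner p) G) (hU : Gᴴ * G = 1) : ∃ U : unitaryGroup (Held owner p → Bit) ℂ, extend owner p U.1 = G := by
  have key : extend owner p
      (Matrix.of fun u v => G (overwrite owner p 0 u) (overwrite owner p 0 v)) = G := by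
    ext w w'
    by_cases h : ∀ i, owner i ≠ p → w i = w' i
    · rw [extend_apply, if_pos h,
        -- Adding the string that equals `w` outside the holdings clears those coordinates, as bits
        -- add modulo 2.
        ← hG.2 _ _ (fun i => if owner i = p then 0 else w i) fun i hi => if_pos hi]
      refine congr_arg₂ G ?_ ?_ <;> funext i <;> by_cases hi : owner i = p <;>
        simp [overwrite, hi, h, CharTwo.add_self_eq_zero]
    · rw [extend_apply, if_neg h]
      by_contra h'
      exact h fun i hi => hG.1 w w' (Ne.symm h') i hi
  refine ⟨⟨_, mem_unitaryGroup_iff'.2 (extend_injective (owner := owner) (p := p) ?_)⟩, key⟩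
  rw [star_eq_conjTranspose, ← extend_mul, ← extend_conjTranspose, key, hU, extend_one]

end Local

/-- Operators on the states of the qubits labelled by `ι`. -/
abbrev Operator (ι : Type) : Type := Matrix (ι → Bit) (ι → Bit) ℂ

/-- The sign `(-1)^b`. -/
def sgn (b : Bit) : ℂ := if b = 0 then 1 else -1

theorem bit_cases (b : Bit) : b = 0 ∨ b = 1 := by
  revert b; decide

theorem sgn_add (a b : Bit) : sgn (a + b) = sgn a * sgn b := by
  rcases bit_cases a with rfl | rfl <;> rcases bit_cases b with rfl | rfl <;>
    simp [sgn, CharTwo.add_self_eq_zero]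

@[simp] theorem sgn_zero : sgn 0 = 1 := rfl

@[simp] theorem sgn_one : sgn 1 = -1 := rfl

theorem sgn_mul_self (a : Bit) : sgn a * sgn a = 1 := by
  rw [← sgn_add, CharTwo.add_self_eq_zero, sgn_zero]

@[simp] theorem star_sgn (a : Bit) : star (sgn a) = sgn a := by
  rcases bit_cases a with rfl | rfl <;> simp

/-! ### Bounds on guessing a classical value from quantum states. -/

section Guess
open scoped ComplexOrder

variable {ι : Type}

theorem IsLocal.diag_eq {T : Set ι} {E : Operator ι} (hE : IsLocal T E) {w w' : ι → Bit}
    (h : ∀ i ∈ T, w i = w' i) : E w w = E w' w' := by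
  have := hE.2 w w (w' - w) fun i hi => by simp [h i hi]
  rw [← this, add_sub_cancel]

variable [Fintype ι] [DecidableEq ι]

/-- The expectation of the observable `E` in the state `ψ`. -/
noncomputable def expect (E : Operator ι) (ψ : State ι) : ℝ := (star ψ ⬝ᵥ E *ᵥ ψ).re

theorem expect_nonneg {E : Operator ι} (hE : E.PosSemidef) (ψ : State ι) : 0 ≤ expect E ψ :=
  hE.re_dotProduct_nonneg ψ

theorem expect_add (E F : Operator ι) (ψ : State ι) :
    expect (E + F) ψ = expect E ψ + expect F ψ := by
  simp [expect, add_mulVec, dotProduct_add]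

theorem expect_smul (c : ℝ) (E : Operator ι) (ψ : State ι) :
    expect (c • E) ψ = c * expect E ψ := by
  simp [expect, smul_mulVec, dotProduct_smul]

theorem expect_mulVec (E W : Operator ι) (ψ : State ι) :
    expect E (W *ᵥ ψ) = expect (Wᴴ * E * W) ψ := by
  simp only [expect, star_mulVec, ← mulVec_mulVec, dotProduct_mulVec, vecMul_vecMul]

variable {X : Type} [Fintype X]

/-- A player who possesses the qubits in `T` guesses `x` from the state `ψ x` by any measurement
with total (unnormalised) success probability at most `c`. -/
def Bounded (T : Set ι) (c : ℝ) (ψ : X → State ι) : Prop :=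
  ∀ E : X → Operator ι, (∀ x, (E x).PosSemidef) → (1 - ∑ x, E x).PosSemidef →
    (∀ x, IsLocal T (E x)) → ∑ x, expect (E x) (ψ x) ≤ c

variable {S T : Set ι} {c : ℝ} {ψ : X → State ι}

theorem Bounded.anti (h : Bounded T c ψ) (hS : S ⊆ T) : Bounded S c ψ :=
  fun E h1 h2 h3 => h E h1 h2 fun x => (h3 x).mono hS

theorem conj_one_sub_sum {W : Operator ι} (hW : Wᴴ * W = 1) {E : X → Operator ι}
    (h : (1 - ∑ x, E x).PosSemidef) : (1 - ∑ x, Wᴴ * E x * W).PosSemidef := by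
  have := h.conjTranspose_mul_mul_same W
  rwa [mul_sub, sub_mul, mul_one, hW, Finset.mul_sum, Finset.sum_mul] at this

/-- The unitary can be absorbed into the measurement. -/
theorem Bounded.own (h : Bounded T c ψ) {W : Operator ι} (hT : IsLocal T W) (hW : Wᴴ * W = 1) :
    Bounded T c fun x => W *ᵥ ψ x := by
  intro E h1 h2 h3
  simp only [expect_mulVec]
  exact h (fun x => Wᴴ * E x * W) (fun x => (h1 x).conjTranspose_mul_mul_same W)
    (conj_one_sub_sum hW h2) fun x => (hT.conjTranspose.mul (h3 x)).mul hT

/-- No signalling: `W` commutes with `E` and cancels against its adjoint. -/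
theorem expect_mulVec_of_disjoint {E W : Operator ι} (hST : Disjoint S T) (hE : IsLocal T E)
    (hS : IsLocal S W) (hW : Wᴴ * W = 1) (ψ : State ι) : expect E (W *ᵥ ψ) = expect E ψ := by
  rw [expect_mulVec, mul_assoc, ← hS.commute hST hE, ← mul_assoc, hW, one_mul]

theorem Bounded.other (h : Bounded T c ψ) {W : Operator ι} (hST : Disjoint S T)
    (hS : IsLocal S W) (hW : Wᴴ * W = 1) : Bounded T c fun x => W *ᵥ ψ x := by
  intro E h1 h2 h3
  simp only [fun x => expect_mulVec_of_disjoint hST (h3 x) hS hW (ψ x)]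
  exact h E h1 h2 h3

/-- The bit flip of qubit `i`. -/
def flipOp (i : ι) : Operator ι := Matrix.of fun w w' => if w' = w + Pi.single i 1 then 1 else 0

/-- The phase flip of qubit `i`. -/
def phaseOp (i : ι) : Operator ι := diagonal fun w => sgn (w i)

theorem add_single_add_single (w : ι → Bit) (i : ι) :
    w + Pi.single i 1 + Pi.single i 1 = w := by
  funext j
  rw [Pi.add_apply, Pi.add_apply, add_assoc, CharTwo.add_self_eq_zero, add_zero]

theorem flipOp_mul_apply (i : ι) (E : Operator ι) (w w' : ι → Bit) :
    (flipOp i * E) w w' = E (w + Pi.single i 1) w' := by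
  simp [mul_apply, flipOp]

theorem flipOp_conjTranspose (i : ι) : (flipOp i)ᴴ = flipOp i := by
  ext w w'
  simp only [conjTranspose_apply, flipOp, of_apply, apply_ite star, star_one, star_zero]
  refine if_congr ⟨fun h => ?_, fun h => ?_⟩ rfl rfl <;> rw [h, add_single_add_single]

theorem mul_flipOp_apply (i : ι) (E : Operator ι) (w w' : ι → Bit) :
    (E * flipOp i) w w' = E w (w' + Pi.single i 1) := by
  have := congrArg star (flipOp_mul_apply i Eᴴ w' w)
  rwa [← conjTranspose_apply, conjTranspose_mul, conjTranspose_conjTranspose,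
    flipOp_conjTranspose, conjTranspose_apply, star_star] at this

theorem phaseOp_conjTranspose (i : ι) : (phaseOp i)ᴴ = phaseOp i := by
  simp [phaseOp, diagonal_conjTranspose, Pi.star_def]

/-- Average of an operator over the Pauli operators on qubit `i`. -/
noncomputable def twirl (i : ι) (E : Operator ι) : Operator ι :=
  (4⁻¹ : ℝ) • ((E + (flipOp i)ᴴ * E * flipOp i) +
    (phaseOp i)ᴴ * (E + (flipOp i)ᴴ * E * flipOp i) * phaseOp i)

/-- Averaging over phase flips kills the entries off-diagonal in qubit `i`, and averaging over bit
flips equalises the two diagonal blocks. What remains is half the partial trace over `i`, tensored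
with the identity. -/
theorem twirl_apply (i : ι) (E : Operator ι) (w w' : ι → Bit) :
    twirl i E w w' = if w i = w' i then
      2⁻¹ * (E w w' + E (w + Pi.single i 1) (w' + Pi.single i 1)) else 0 := by
  rw [twirl, phaseOp_conjTranspose, flipOp_conjTranspose, Matrix.smul_apply, Matrix.add_apply, phaseOp,
    mul_diagonal, diagonal_mul, Matrix.add_apply, mul_flipOp_apply, flipOp_mul_apply]
  split_ifs with h
  · rw [h, mul_right_comm, sgn_mul_self, Complex.real_smul]
    push_cast
    ring
  · have : sgn (w i) * sgn (w' i) = -1 := by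
      rcases bit_cases (w i) with h1 | h1 <;> rcases bit_cases (w' i) with h2 | h2 <;>
        simp_all
    rw [mul_right_comm, this, neg_one_mul, add_neg_cancel, smul_zero]

theorem posSemidef_twirl {i : ι} {E : Operator ι} (hE : E.PosSemidef) : (twirl i E).PosSemidef := by
  have h := hE.add (hE.conjTranspose_mul_mul_same (flipOp i))
  exact (h.add (h.conjTranspose_mul_mul_same (phaseOp i))).smul (by norm_num)

/-- `E` itself is one of the four positive terms averaged by the twirl. -/
theorem expect_le_twirl {i : ι} {E : Operator ι} (hE : E.PosSemidef) (ψ : State ι) :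
    expect E ψ ≤ 4 * expect (twirl i E) ψ := by
  have h := hE.conjTranspose_mul_mul_same (flipOp i)
  have h' := (hE.add h).conjTranspose_mul_mul_same (phaseOp i)
  have e1 := expect_nonneg h ψ
  have e2 := expect_nonneg h' ψ
  rw [twirl, expect_smul, expect_add, expect_add]
  linarith

theorem IsLocal.twirl {i : ι} {E : Operator ι} (hE : IsLocal (insert i T) E) :
    IsLocal T (twirl i E) := by
  refine ⟨fun w w' hw j hj => ?_, fun w w' t ht => ?_⟩
  · rw [twirl_apply] at hw
    split_ifs at hw with h
    · by_cases hji : j = i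
      · rw [hji, h]
      · have hj' : j ∉ insert i T := by simp [hji, hj]
        by_cases h1 : E w w' = 0
        · rw [h1, zero_add] at hw
          simpa using hE.1 _ _ (right_ne_zero_of_mul hw) j hj'
        · exact hE.1 _ _ h1 j hj'
    · exact absurd rfl hw
  · rw [twirl_apply, twirl_apply]
    simp only [Pi.add_apply, add_left_inj]
    congr 2
    -- `t` may be nonzero at `i`, where `E` is not translation invariant; `t'` drops that
    -- coordinate, and the remaining flip of `i` only swaps the two summands.
    set t' : ι → Bit := Function.update t i 0 with ht'
    have key : ∀ v v', E (v + t') (v' + t') = E v v' := fun v v' => hE.2 v v' t' fun j hj => by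
      by_cases hji : j = i
      · rw [hji, ht', Function.update_self]
      · rw [ht', Function.update_of_ne hji]
        exact ht j (hj.resolve_left hji)
    have ht2 : t = t' + Pi.single i (t i) := by
      funext j
      by_cases hji : j = i
      · subst hji; simp [ht']
      · simp [ht', hji]
    rcases bit_cases (t i) with h | h
    · rw [h, Pi.single_zero, add_zero] at ht2
      rw [ht2, key, add_right_comm, add_right_comm w', key]
    · rw [h] at ht2
      rw [ht2, ← add_assoc, ← add_assoc, add_single_add_single, add_single_add_single,
        key, add_right_comm, add_right_comm w', key, add_comm]

/-- The twirl is linear, positive and fixes the identity. -/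
theorem one_sub_sum_twirl (i : ι) {E : X → Operator ι} (h : (1 - ∑ x, E x).PosSemidef) :
    (1 - ∑ x, twirl i (E x)).PosSemidef := by
  have key : 1 - ∑ x, twirl i (E x) = twirl i (1 - ∑ x, E x) := by
    ext w w'
    rw [twirl_apply]
    simp only [Matrix.sub_apply, Matrix.sum_apply, twirl_apply, one_apply, add_left_inj]
    split_ifs with h1 h2 h2
    · rw [← Finset.mul_sum, Finset.sum_add_distrib]; ring
    · exact absurd (congrFun h1 i) h2
    · rw [← Finset.mul_sum, Finset.sum_add_distrib]; ring
    · simp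
  rw [key]
  exact posSemidef_twirl h

/-- The superdense coding limit: the twirled measurement ignores qubit `i`, and twirling loses at
most a factor 4. -/
theorem Bounded.insert (h : Bounded T c ψ) (i : ι) : Bounded (insert i T) (4 * c) ψ := by
  intro E h1 h2 h3
  calc _ ≤ ∑ x, 4 * expect (twirl i (E x)) (ψ x) :=
        Finset.sum_le_sum fun x _ => expect_le_twirl (h1 x) _
    _ ≤ _ := by
        rw [← Finset.mul_sum]
        exact mul_le_mul_of_nonneg_left (h _ (fun x => posSemidef_twirl (h1 x))
          (one_sub_sum_twirl i h2) fun x => (h3 x).twirl) (by norm_num)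

theorem Bounded.union (h : Bounded T c ψ) (S : Finset ι) :
    Bounded (T ∪ S) (4 ^ S.card * c) ψ := by
  induction S using Finset.induction_on with
  | empty => simpa using h
  | insert i S hi ih =>
    rw [Finset.card_insert_of_notMem hi, Finset.coe_insert, Set.union_insert, pow_succ', mul_assoc]
    exact ih.insert i

/-- Before any communication to it, the part in `T` is in a fixed pure state, up to normalisation,
and in particular unentangled with the rest. -/
def Fresh (T : Set ι) (ψ : X → State ι) : Prop :=
  ∃ (W : Operator ι) (u : ι → Bit) (φ : X → State ι), IsLocal T W ∧ Wᴴ * W = 1 ∧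
    (∀ x, ψ x = W *ᵥ φ x) ∧ (∀ x w, φ x w ≠ 0 → ∀ i ∈ T, w i = u i) ∧
    ∀ x, ∑ w, star (φ x w) * φ x w = 1

theorem Fresh.own (h : Fresh T ψ) {V : Operator ι} (hT : IsLocal T V) (hV : Vᴴ * V = 1) :
    Fresh T fun x => V *ᵥ ψ x := by
  obtain ⟨W, u, φ, h1, h2, h3, h4⟩ := h
  refine ⟨V * W, u, φ, hT.mul h1, ?_, fun x => ?_, h4⟩
  · rw [conjTranspose_mul, mul_assoc, ← mul_assoc Vᴴ, hV, one_mul, h2]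
  · simp only [h3, mulVec_mulVec]

theorem Fresh.other (h : Fresh T ψ) {V : Operator ι} (hST : Disjoint S T) (hS : IsLocal S V)
    (hV : Vᴴ * V = 1) : Fresh T fun x => V *ᵥ ψ x := by
  obtain ⟨W, u, φ, h1, h2, h3, h4, h5⟩ := h
  refine ⟨W, u, fun x => V *ᵥ φ x, h1, h2, fun x => ?_, fun x w hw i hi => ?_, fun x => ?_⟩
  · simp only [h3, mulVec_mulVec, hS.commute hST h1]
  · obtain ⟨w', -, hw'⟩ := Finset.exists_ne_zero_of_sum_ne_zero hw
    rw [hS.1 _ _ (left_ne_zero_of_mul hw') i fun h => hST.le_bot ⟨h, hi⟩]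
    exact h4 x w' (right_ne_zero_of_mul hw') i hi
  · rw [← h5 x]
    change star (V *ᵥ φ x) ⬝ᵥ (V *ᵥ φ x) = star (φ x) ⬝ᵥ φ x
    rw [star_mulVec, dotProduct_mulVec, vecMul_vecMul, hV, vecMul_one]

theorem Bounded.of_conj {W : Operator ι} {φ : X → State ι} (hT : IsLocal T W) (hW : Wᴴ * W = 1)
    (h3 : ∀ x, ψ x = W *ᵥ φ x) (h : Bounded T c φ) : Bounded T c ψ := by
  rw [show ψ = fun x => W *ᵥ φ x from funext h3]
  exact h.own hT hW

theorem sum_diag_le {E : X → Operator ι} (h : (1 - ∑ x, E x).PosSemidef) (w : ι → Bit) :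
    ∑ x, (E x w w).re ≤ 1 := by
  have := (Complex.le_def.1 (h.diag_nonneg (i := w))).1
  simp only [Matrix.sub_apply, Matrix.sum_apply, one_apply_eq, Complex.sub_re, Complex.re_sum] at this
  simpa using this

/-- The state on `T` does not depend on `x`, so the success probabilities are those of disjoint
outcomes of one measurement on one state. -/
theorem Fresh.bounded (h : Fresh T ψ) : Bounded T 1 ψ := by
  obtain ⟨W, u, φ, h1, h2, h3, h4, h5⟩ := h
  refine Bounded.of_conj h1 h2 h3 fun E p1 p2 p3 => ?_
  refine le_of_eq_of_le (Finset.sum_congr rfl fun x _ => ?_) (sum_diag_le p2 u)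
  rw [expect, ← mul_one (E x u u), ← h5 x, Finset.mul_sum, dotProduct]
  congr 1
  refine Finset.sum_congr rfl fun w _ => ?_
  by_cases hw : φ x w = 0
  · simp [hw]
  · rw [mulVec, dotProduct, Finset.sum_eq_single w, (p3 x).diag_eq (h4 x w hw), Pi.star_apply]
    · ring
    · intro w' _ hne
      by_contra h'
      refine hne (funext fun i => ?_)
      by_cases hi : i ∈ T
      · rw [h4 x w hw i hi, h4 x w' (right_ne_zero_of_mul h') i hi]
      · exact ((p3 x).1 _ _ (left_ne_zero_of_mul h') i hi).symm
    · simp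

/-- Strings in the support of `φ` agree on `T`, and `E` changes nothing outside `insert i T`, so `E`
can connect `w` only to itself and to its flip at `i`. -/
theorem dotProduct_of_fixed {i : ι} {E : Operator ι} (hE : IsLocal (insert i T) E) {φ : State ι}
    {u : ι → Bit} (hφ : ∀ w, φ w ≠ 0 → ∀ i ∈ T, w i = u i) :
    star φ ⬝ᵥ E *ᵥ φ = ∑ w, star (φ w) * (E w w * φ w +
      E w (w + Pi.single i 1) * φ (w + Pi.single i 1)) := by
  rw [dotProduct]
  refine Finset.sum_congr rfl fun w _ => ?_
  rw [Pi.star_apply]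
  by_cases hw : φ w = 0
  · simp [hw]
  · congr 1
    have hne : w ≠ w + Pi.single i 1 := fun h => by simpa using congrFun h i
    rw [mulVec, dotProduct, ← Finset.sum_pair (f := fun v => E w v * φ v) hne]
    refine (Finset.sum_subset (Finset.subset_univ _) fun v _ hv => ?_).symm
    by_contra h'
    have hv' : ∀ j, j ≠ i → v j = w j := fun j hj => by
      by_cases hjT : j ∈ T
      · rw [hφ w hw j hjT, hφ v (right_ne_zero_of_mul h') j hjT]
      · exact (hE.1 _ _ (left_ne_zero_of_mul h') j (by simp [hj, hjT])).symm
    simp only [Finset.mem_insert, Finset.mem_singleton, not_or] at hv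
    have hi : v i ≠ w i := fun h => hv.1 <| funext fun j => by
      by_cases hj : j = i
      · rw [hj, h]
      · exact hv' j hj
    refine hv.2 (funext fun j => ?_)
    by_cases hj : j = i
    · subst hj
      rcases bit_cases (v j) with a | a <;> rcases bit_cases (w j) with b | b <;>
        simp_all [CharTwo.add_self_eq_zero]
    · simp [hj, hv' j hj]

/-- The state on `insert i T` is |u⟩⟨u| ⊗ ρ with ρ a one-qubit density matrix, and ρ ≤ 1. The
right-hand side is the expectation with ρ replaced by 1. -/
theorem expect_le_of_fixed {i : ι} (hi : i ∉ T) {E : Operator ι} (hE : IsLocal (insert i T) E)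
    (hp : E.PosSemidef) {φ : State ι} {u : ι → Bit} (hφ : ∀ w, φ w ≠ 0 → ∀ i ∈ T, w i = u i)
    (h1 : ∑ w, star (φ w) * φ w = 1) :
    expect E φ ≤ (E u u).re + (E (u + Pi.single i 1) (u + Pi.single i 1)).re := by
  set e : ι → Bit := Pi.single i 1 with he
  have hee : ∀ w, w + e + e = w := fun w => add_single_add_single w i
  have hsg : ∀ w : ι → Bit, sgn ((w + e) i) = - sgn (w i) := fun w => by
    simp [he, sgn_add]
  -- The spin flip of `φ`: complex conjugation followed by a Pauli Y on qubit `i`, up to phase. It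
  -- replaces ρ by 1 - ρ.
  set φ' : State ι := fun w => sgn (w i) * star (φ (w + e)) with hφ'
  have hs' : ∀ w, φ' w ≠ 0 → ∀ i ∈ T, w i = u i := fun w hw j hj => by
    have hji : j ≠ i := fun h => hi (h ▸ hj)
    have := hφ (w + e) (fun h => hw (by simp [hφ', h])) j hj
    simpa [he, hji] using this
  -- The trace over qubit `i` does not see whether `w` agrees with `u` at `i`.
  have tr : ∀ w, φ w ≠ 0 → E w w + E (w + e) (w + e) = E u u + E (u + e) (u + e) := by
    intro w hw
    by_cases h : w i = u i
    · have hwu : ∀ j ∈ insert i T, w j = u j := by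
        rintro j (rfl | hj)
        exacts [h, hφ w hw j hj]
      rw [hE.diag_eq hwu, hE.diag_eq (w := w + e) (w' := u + e) fun j hj => by simp [hwu j hj]]
    · have hwu : ∀ j ∈ insert i T, w j = (u + e) j := by
        rintro j (rfl | hj)
        · rcases bit_cases (w j) with a | a <;> rcases bit_cases (u j) with b | b <;>
            simp_all [CharTwo.add_self_eq_zero]
        · have hji : j ≠ i := fun h => hi (h ▸ hj)
          simp [he, hji, hφ w hw j hj]
      rw [hE.diag_eq hwu, hE.diag_eq (w := w + e) (w' := u + e + e) fun j hj => by
        simp [hwu j hj], hee, add_comm]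
  have key : star φ ⬝ᵥ E *ᵥ φ + star φ' ⬝ᵥ E *ᵥ φ' = E u u + E (u + e) (u + e) := by
    have shift : ∑ w, φ (w + e) * star (φ (w + e)) * E w w
        = ∑ w, φ w * star (φ w) * E (w + e) (w + e) :=
      Fintype.sum_equiv (Equiv.addRight e) _ _ fun w => by
        rw [Equiv.coe_addRight, hee]
    calc _ = ∑ w, φ w * star (φ w) * E w w + ∑ w, φ (w + e) * star (φ (w + e)) * E w w := by
          rw [dotProduct_of_fixed hE hφ, dotProduct_of_fixed hE hs', ← Finset.sum_add_distrib,
            ← Finset.sum_add_distrib]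
          refine Finset.sum_congr rfl fun w _ => ?_
          simp only [hφ', ← he, star_mul', star_star, star_sgn, hsg, hee]
          linear_combination (φ (w + e) * star (φ (w + e)) * E w w
            - φ (w + e) * E w (w + e) * star (φ w)) * sgn_mul_self (w i)
      _ = ∑ w, star (φ w) * φ w * (E u u + E (u + e) (u + e)) := by
          rw [shift, ← Finset.sum_add_distrib]
          refine Finset.sum_congr rfl fun w _ => ?_
          by_cases hw : φ w = 0
          · simp [hw]
          · rw [← tr w hw]; ring
      _ = _ := by rw [← Finset.sum_mul, h1, one_mul]
  have h0 := expect_nonneg hp φ'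
  have := congrArg Complex.re key
  rw [Complex.add_re, Complex.add_re] at this
  rw [expect] at h0 ⊢
  linarith

/-- Without prior entanglement a qubit carries only one bit: the two diagonal entries of each `E x`
bounding its success each sum to at most 1 over `x`. -/
theorem Fresh.insert (h : Fresh T ψ) {i : ι} (hi : i ∉ T) : Bounded (insert i T) 2 ψ := by
  obtain ⟨W, u, φ, h1, h2, h3, h4, h5⟩ := h
  refine Bounded.of_conj (h1.mono (Set.subset_insert i T)) h2 h3 fun E p1 p2 p3 => ?_
  calc _ ≤ ∑ x, ((E x u u).re + (E x (u + Pi.single i 1) (u + Pi.single i 1)).re) :=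
        Finset.sum_le_sum fun x _ => expect_le_of_fixed hi (p3 x) (p1 x) (h4 x) (h5 x)
    _ ≤ 1 + 1 := by
        rw [Finset.sum_add_distrib]
        exact add_le_add (sum_diag_le p2 _) (sum_diag_le p2 _)
    _ = 2 := by norm_num

end Guess

theorem Player.other_ne (p : Player) : p.other ≠ p := by cases p <;> simp [Player.other]

theorem Player.eq_other {p q : Player} (h : q ≠ p) : q = p.other := by
  cases p <;> cases q <;> simp_all [Player.other]

/-! ### Information received in the course of a protocol. -/

section Turns
variable {ι : Type}

theorem disjoint_holdings (owner : ι → Player) {p q : Player} (h : q ≠ p) :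
    Disjoint (holdings owner q) (holdings owner p) :=
  Set.disjoint_left.2 fun _ h1 h2 => h (h1.symm.trans h2)

variable [DecidableEq ι]

theorem holdings_transfer (owner : ι → Player) (p : Player) (S : Finset ι) :
    holdings (transfer owner p S) p ⊆ holdings owner p := by
  intro i hi
  simp only [holdings, transfer, Set.mem_ofPred_eq] at hi ⊢
  split_ifs at hi with h
  · exact absurd hi p.other_ne
  · exact hi

theorem holdings_transfer_other (owner : ι → Player) (p : Player) (S : Finset ι) :
    holdings (transfer owner p S) p.other = holdings owner p.other ∪ S := by
  ext i
  by_cases h : i ∈ S <;> simp [holdings, transfer, h]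

theorem transfer_empty (owner : ι → Player) (p : Player) : transfer owner p ∅ = owner := by
  funext i
  simp [transfer]

variable [Fintype ι]

/-- The number of qubits sent to player `p`. -/
def Turns.received (p : Player) :
    {q : Player} → {owner : ι → Player} → Turns q owner → ℕ
  | _, _, .done _ _ => 0
  | _, _, .turn q _ _ S _ rest => (if q = p then 0 else S.card) + rest.received p

/-- A bound on the number of bits that player `p` can learn when the initial state is fresh:
two bits for every qubit that is sent to `p`, except that the very first qubit of the protocol
carries only one bit. -/
def Turns.gain (p : Player) :
    {q : Player} → {owner : ι → Player} → Turns q owner → ℕ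
  | _, _, .done _ _ => 0
  | _, _, .turn q _ _ S _ rest =>
    if S = ∅ then rest.gain p
    else if q = p then 2 * rest.received p
    else (2 * (S.card - 1) + 1) + 2 * rest.received p

theorem Turns.received_add_received {q : Player} {owner : ι → Player} (t : Turns q owner) :
    t.received .alice + t.received .bob = t.cost := by
  induction t with
  | done => rfl
  | turn q owner U S hS rest ih =>
    simp only [received, cost, ← ih]
    cases q <;> simp <;> omega

/-- The first qubit sent has exactly one receiver, for whom it counts one bit instead of two. If
nothing is sent, the truncated subtraction gives 0 on both sides. -/
theorem Turns.gain_add_gain {q : Player} {owner : ι → Player} (t : Turns q owner) :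
    t.gain .alice + t.gain .bob ≤ 2 * t.cost - 1 := by
  induction t with
  | done => simp [gain]
  | turn q owner U S hS rest ih =>
    have := rest.received_add_received
    by_cases h : S = ∅
    · simp [gain, cost, h, ih]
    · have hc := Finset.card_pos.2 (Finset.nonempty_iff_ne_empty.2 h)
      cases q <;> simp [gain, cost, h] <;> omega

/-- The state after the turns depends linearly on the initial state. -/
theorem Turns.exists_run_eq {q : Player} {owner : ι → Player} (t : Turns q owner) :
    ∃ G : Operator ι, ∀ ψ, t.run ψ = G *ᵥ ψ := by
  induction t with
  | done => exact ⟨1, fun ψ => (one_mulVec ψ).symm⟩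
  | turn q owner U S hS rest ih =>
    obtain ⟨G, hG⟩ := ih
    exact ⟨G * extend owner q U.1, fun ψ => by
      rw [run, hG, applyLocal_eq, mulVec_mulVec]⟩

variable {X : Type} [Fintype X]

theorem Bounded.applyLocal {p q : Player} {owner : ι → Player} {c : ℝ} {ψ : X → State ι}
    (h : Bounded (holdings owner p) c ψ) (U : unitaryGroup (Held owner q → Bit) ℂ) :
    Bounded (holdings owner p) c fun x => applyLocal owner q U.1 (ψ x) := by
  simp only [applyLocal_eq]
  by_cases hqp : q = p
  · subst hqp
    exact h.own (isLocal_extend U.1) (extend_unitary U)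
  · exact h.other (disjoint_holdings owner hqp) (isLocal_extend U.1) (extend_unitary U)

theorem Fresh.applyLocal {p q : Player} {owner : ι → Player} {ψ : X → State ι}
    (h : Fresh (holdings owner p) ψ) (U : unitaryGroup (Held owner q → Bit) ℂ) :
    Fresh (holdings owner p) fun x => applyLocal owner q U.1 (ψ x) := by
  simp only [applyLocal_eq]
  by_cases hqp : q = p
  · subst hqp
    exact h.own (isLocal_extend U.1) (extend_unitary U)
  · exact h.other (disjoint_holdings owner hqp) (isLocal_extend U.1) (extend_unitary U)

theorem Bounded.run {p q : Player} {owner : ι → Player} (t : Turns q owner) {c : ℝ}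
    {ψ : X → State ι} (h : Bounded (holdings owner p) c ψ) :
    Bounded (holdings t.finalOwner p) (2 ^ (2 * t.received p) * c) fun x => t.run (ψ x) := by
  induction t generalizing c ψ with
  | done => simpa [Turns.finalOwner, Turns.run, Turns.received] using h
  | turn q owner U S hS rest ih =>
    have h1 := h.applyLocal U
    by_cases hqp : q = p
    · subst hqp
      simpa [Turns.finalOwner, Turns.run, Turns.received] using ih (h1.anti (holdings_transfer owner q S))
    · obtain rfl : p = q.other := Player.eq_other (Ne.symm hqp)
      have h2 := h1.union S
      rw [← holdings_transfer_other] at h2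
      have h3 := ih h2
      rw [← mul_assoc, show (4 : ℝ) = 2 ^ 2 by norm_num, ← pow_mul, ← pow_add,
        ← mul_add, add_comm] at h3
      simpa [Turns.finalOwner, Turns.run, Turns.received, hqp] using h3

theorem Fresh.run {p q : Player} {owner : ι → Player} (t : Turns q owner)
    {ψ : X → State ι} (h : Fresh (holdings owner p) ψ) :
    Bounded (holdings t.finalOwner p) (2 ^ t.gain p) fun x => t.run (ψ x) := by
  induction t generalizing ψ with
  | done => simpa [Turns.finalOwner, Turns.run, Turns.gain] using h.bounded
  | turn q owner U S hS rest ih =>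
    have h1 := h.applyLocal U
    by_cases hSe : S = ∅
    · subst hSe
      simpa [Turns.finalOwner, Turns.run, Turns.gain] using ih (by rwa [transfer_empty])
    · by_cases hqp : q = p
      · subst hqp
        -- Having sent qubits, `q` may be entangled with the other player; freshness is given up and
        -- every later qubit counts two bits.
        simpa [Turns.finalOwner, Turns.run, Turns.gain, hSe] using (h1.bounded.anti (holdings_transfer owner q S)).run rest
      · obtain rfl : p = q.other := Player.eq_other (Ne.symm hqp)
        obtain ⟨i, hi⟩ := Finset.nonempty_iff_ne_empty.2 hSe
        have hiT : i ∉ holdings owner q.other := fun h => hqp ((hS i hi).symm.trans h)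
        -- One qubit `i` of the first message gains the factor 2, the others 4 each.
        have h2 := (h1.insert hiT).union (S.erase i)
        rw [Set.insert_union, ← Set.union_insert, ← Finset.coe_insert, Finset.insert_erase hi,
          ← holdings_transfer_other] at h2
        have h3 := h2.run rest
        rw [show (4 : ℝ) = 2 ^ 2 by norm_num, ← pow_mul, ← pow_succ, ← pow_add,
          Finset.card_erase_of_mem hi, add_comm] at h3
        simpa [Turns.finalOwner, Turns.run, Turns.gain, hSe, hqp] using h3

end Turns

/-! ### Hadamard transforms and reading out a register. -/

section Hadamard
open scoped ComplexOrder

variable {ι : Type} [Fintype ι]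

/-- The tensor product of one-qubit operators. -/
def tens (h : ι → Matrix Bit Bit ℂ) : Operator ι := Matrix.of fun w w' => ∏ i, h i (w i) (w' i)

theorem tens_one : tens (1 : ι → Matrix Bit Bit ℂ) = 1 := by
  ext w w'
  simp only [tens, of_apply, Pi.one_apply, one_apply, funext_iff]
  by_cases h : ∀ i, w i = w' i
  · simp [h]
  · rw [if_neg h]
    push Not at h
    obtain ⟨i, hi⟩ := h
    exact Finset.prod_eq_zero (Finset.mem_univ i) (if_neg hi)

theorem tens_conjTranspose (h : ι → Matrix Bit Bit ℂ) : (tens h)ᴴ = tens fun i => (h i)ᴴ := by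
  ext w w'
  simp [tens, conjTranspose_apply]

theorem isLocal_tens {T : Set ι} {h : ι → Matrix Bit Bit ℂ} (hT : ∀ i, i ∉ T → h i = 1) :
    IsLocal T (tens h) := by
  refine ⟨fun w w' hw i hi => ?_, fun w w' t ht => ?_⟩
  · have := Finset.prod_ne_zero_iff.1 hw i (Finset.mem_univ i)
    by_contra h'
    rw [hT i hi, one_apply_ne h'] at this
    exact this rfl
  · refine Finset.prod_congr rfl fun i _ => ?_
    by_cases hi : i ∈ T
    · simp [ht i hi]
    · simp [hT i hi, one_apply]

/-- The one-qubit Hadamard operator. -/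
noncomputable def hadamard : Matrix Bit Bit ℂ :=
  Matrix.of fun a b => ((√2 : ℝ) : ℂ)⁻¹ * sgn (a * b)

theorem hadamard_conjTranspose : hadamardᴴ = hadamard := by
  ext a b
  simp [hadamard, conjTranspose_apply, mul_comm, -Complex.ofReal_inv]

theorem hadamard_mul_self : hadamard * hadamard = 1 := by
  have h2 : ((√2 : ℝ) : ℂ)⁻¹ * ((√2 : ℝ) : ℂ)⁻¹ = 2⁻¹ := by
    rw [← mul_inv, ← Complex.ofReal_mul, Real.mul_self_sqrt (by norm_num)]
    norm_num
  have hsum : ∀ f : Bit → ℂ, ∑ b, f b = f 0 + f 1 := fun f => Fin.sum_univ_two f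
  ext a c
  simp only [mul_apply, hsum, hadamard, of_apply]
  rcases bit_cases a with rfl | rfl <;> rcases bit_cases c with rfl | rfl <;>
    simp [h2] <;> norm_num

theorem sgn_sum {κ : Type} (s : Finset κ) (f : κ → Bit) :
    sgn (∑ k ∈ s, f k) = ∏ k ∈ s, sgn (f k) := by
  classical
  induction s using Finset.induction_on with
  | empty => rfl
  | insert k s hk ih => rw [Finset.sum_insert hk, Finset.prod_insert hk, sgn_add, ih]

variable [DecidableEq ι]

theorem tens_mul (h h' : ι → Matrix Bit Bit ℂ) : tens h * tens h' = tens (h * h') := by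
  ext w w'
  simp only [tens, mul_apply, of_apply, ← Finset.prod_mul_distrib, Pi.mul_apply]
  exact (Fintype.prod_sum fun i b => h i (w i) b * h' i b (w' i)).symm

variable {κ : Type} [Fintype κ]

/-- The Hadamard operators on all the qubits labelled by `f`. -/
noncomputable def hadamardOn (f : κ ↪ ι) : Operator ι :=
  tens fun i => if i ∈ Finset.univ.map f then hadamard else 1

theorem hadamardOn_conjTranspose (f : κ ↪ ι) : (hadamardOn f)ᴴ = hadamardOn f := by
  simp only [hadamardOn, tens_conjTranspose, apply_ite conjTranspose, hadamard_conjTranspose,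
    conjTranspose_one]

theorem hadamardOn_mul_self (f : κ ↪ ι) : hadamardOn f * hadamardOn f = 1 := by
  rw [hadamardOn, tens_mul, ← tens_one]
  congr 1
  funext i
  by_cases h : i ∈ Finset.univ.map f <;> simp only [Pi.mul_apply, h, if_true, if_false,
    hadamard_mul_self, one_mul, Pi.one_apply]

theorem hadamardOn_unitary (f : κ ↪ ι) : (hadamardOn f)ᴴ * hadamardOn f = 1 := by
  rw [hadamardOn_conjTranspose, hadamardOn_mul_self]

theorem isLocal_hadamardOn (f : κ ↪ ι) : IsLocal (Set.range f) (hadamardOn f) :=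
  isLocal_tens fun i hi => if_neg fun h => hi (by simpa using h)

theorem hadamardOn_apply (f : κ ↪ ι) {w w' : ι → Bit} (h : ∀ i, i ∉ Set.range f → w i = w' i) :
    hadamardOn f w w' =
      ((√2 : ℝ) : ℂ)⁻¹ ^ Fintype.card κ * sgn (∑ k, w (f k) * w' (f k)) := by
  have hprod : hadamardOn f w w' = ∏ i ∈ Finset.univ.map f, hadamard (w i) (w' i) := by
    rw [hadamardOn, tens, of_apply, ← Finset.prod_subset (Finset.subset_univ (Finset.univ.map f))]
    · exact Finset.prod_congr rfl fun i hi => by rw [if_pos hi]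
    · intro i _ hi
      rw [if_neg hi, h i fun h' => hi (by simpa using h'), one_apply_eq]
  rw [hprod, Finset.prod_map]
  simp only [hadamard, of_apply, Finset.prod_mul_distrib, sgn_sum, Finset.prod_const,
    Finset.card_univ]

theorem mulVec_ket (G : Operator ι) (w w' : ι → Bit) : (G *ᵥ ket w) w' = G w' w := by
  simp [ket]

variable [DecidableEq κ]

theorem hadamardOn_mulVec_ket (f : κ ↪ ι) (w : ι → Bit) :
    hadamardOn f *ᵥ ket w = ∑ v : κ → Bit,
      (((√2 : ℝ) : ℂ)⁻¹ ^ Fintype.card κ * sgn (∑ k, v k * w (f k))) •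
        ket (Function.extend f v w) := by
  funext w'
  rw [mulVec_ket, Finset.sum_apply]
  simp only [Pi.smul_apply, ket, Pi.single_apply, smul_eq_mul, mul_ite, mul_one, mul_zero]
  by_cases h : ∀ i, i ∉ Set.range f → w' i = w i
  · rw [hadamardOn_apply f h, Finset.sum_eq_single (w' ∘ f), if_pos]
    · rfl
    · funext i
      by_cases hi : i ∈ Set.range f
      · obtain ⟨k, rfl⟩ := hi
        rw [f.injective.extend_apply, Function.comp_apply]
      · rw [h i hi, Function.extend_apply' _ _ _ hi]
    · intro v _ hv
      refine if_neg fun h' => hv ?_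
      funext k
      rw [h', Function.comp_apply, f.injective.extend_apply]
    · simp
  · rw [Finset.sum_eq_zero fun v _ => if_neg fun h' => h fun i hi => ?_]
    · by_contra h'
      exact h fun i hi => (isLocal_hadamardOn f).1 _ _ h' i hi
    · rw [h', Function.extend_apply' _ _ _ hi]

/-- The projection to the strings that agree with `x` on the qubits labelled by `f`. -/
def readout (f : κ ↪ ι) (x : κ → Bit) : Operator ι := diagonal fun w => if w ∘ f = x then 1 else 0

theorem isLocal_readout (f : κ ↪ ι) (x : κ → Bit) : IsLocal (Set.range f) (readout f x) := by
  refine ⟨fun w w' hw i _ => ?_, fun w w' t ht => ?_⟩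
  · by_cases h : w = w'
    · rw [h]
    · exact absurd (diagonal_apply_ne _ h) hw
  · have : ∀ w, (w + t) ∘ f = w ∘ f := fun w => funext fun k => by simp [ht]
    simp [readout, diagonal_apply, this]

theorem sum_readout (f : κ ↪ ι) : ∑ x, readout f x = 1 := by
  ext w w'
  by_cases h : w = w'
  · subst h
    simp [readout, Matrix.sum_apply]
  · simp [readout, Matrix.sum_apply, h]

theorem expect_readout_ket (f : κ ↪ ι) (w : ι → Bit) : expect (readout f (w ∘ f)) (ket w) = 1 := by
  simp [expect, ket, readout, dotProduct_single]

/-- If `x` can be read out in the Hadamard basis, then it can be guessed with certainty. -/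
theorem Bounded.two_pow_le {T : Set ι} {c : ℝ} (f : κ ↪ ι) {φ : (κ → Bit) → State ι}
    (h : Bounded T c fun x => hadamardOn f *ᵥ φ x) (hT : Set.range f ⊆ T)
    (hφ : ∀ x, expect (readout f x) (φ x) = 1) : 2 ^ Fintype.card κ ≤ c := by
  have hp : ∀ x, (readout f x).PosSemidef := fun x => by
    refine PosSemidef.diagonal fun w => ?_
    dsimp only [Pi.zero_apply]
    split_ifs <;> simp
  have hl := (isLocal_hadamardOn f)
  have key := h (fun x => (hadamardOn f)ᴴ * readout f x * hadamardOn f)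
    (fun x => (hp x).conjTranspose_mul_mul_same _)
    (by
      rw [← Finset.sum_mul, ← Finset.mul_sum, sum_readout, mul_one, hadamardOn_unitary, sub_self]
      exact PosSemidef.zero)
    (fun x => ((hl.conjTranspose.mul (isLocal_readout f x)).mul hl).mono hT)
  have e : ∀ x, expect ((hadamardOn f)ᴴ * readout f x * hadamardOn f) (hadamardOn f *ᵥ φ x) = 1 := by
    intro x
    rw [← expect_mulVec, mulVec_mulVec, hadamardOn_mul_self, one_mulVec, hφ]
  simp only [e] at key
  simpa using key

end Hadamard

/-! ### The lower bound: a clean protocol transmits both inputs. -/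

section LowerBound
variable {n a b : ℕ}

/-- Alice's input register. -/
def aliceInput : Fin n ↪ Qubits n a b :=
  ⟨fun i => .inl (.inl (.inl i)), fun i j h => by simpa using h⟩

/-- Bob's input register. -/
def bobInput : Fin n ↪ Qubits n a b :=
  ⟨fun i => .inl (.inr (.inl i)), fun i j h => by simpa using h⟩

/-- The answer register. -/
def answerRegister : Unit ↪ Qubits n a b := ⟨fun _ => .inr (), fun _ _ _ => rfl⟩

@[simp] theorem aliceInput_apply (i : Fin n) :
    (aliceInput i : Qubits n a b) = .inl (.inl (.inl i)) := rfl

@[simp] theorem bobInput_apply (i : Fin n) :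
    (bobInput i : Qubits n a b) = .inl (.inr (.inl i)) := rfl

@[simp] theorem answerRegister_apply (i : Unit) :
    (answerRegister i : Qubits n a b) = .inr () := rfl

theorem extend_aliceInput (x y v : Fin n → Bit) (z : Bit) :
    Function.extend aliceInput v (config (a := a) (b := b) x y z) = config v y z := by
  funext i
  rcases i with ((i | i) | (i | i)) | i
  · exact aliceInput.injective.extend_apply _ _ i
  all_goals exact Function.extend_apply' _ _ _ (by simp)

theorem extend_bobInput (x y v : Fin n → Bit) (z : Bit) :
    Function.extend bobInput v (config (a := a) (b := b) x y z) = config x v z := by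
  funext i
  rcases i with ((i | i) | (i | i)) | i
  · exact Function.extend_apply' _ _ _ (by simp)
  · exact Function.extend_apply' _ _ _ (by simp)
  · exact bobInput.injective.extend_apply _ _ i
  all_goals exact Function.extend_apply' _ _ _ (by simp)

theorem extend_answerRegister (x y : Fin n → Bit) (z : Bit) (v : Unit → Bit) :
    Function.extend answerRegister v (config (a := a) (b := b) x y z) = config x y (v ()) := by
  funext i
  rcases i with i | i
  · rw [Function.extend_apply' _ _ _ (by simp)]
    rcases i with (i | i) | (i | i) <;> rfl
  · exact answerRegister.injective.extend_apply _ _ ()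

/-- The inputs `x` and `y` together with the answer register in the state `|-⟩`. -/
noncomputable def minusState (x y : Fin n → Bit) : State (Qubits n a b) :=
  hadamardOn answerRegister *ᵥ ket (config x y 1)

theorem minusState_eq (x y : Fin n → Bit) :
    minusState (a := a) (b := b) x y =
      ∑ v : Unit → Bit, (((√2 : ℝ) : ℂ)⁻¹ * sgn (v ())) • ket (config x y (v ())) := by
  simp [minusState, hadamardOn_mulVec_ket, extend_answerRegister, config]

/-- Computing `f` cleanly is a phase query to `f` on `|-⟩`. -/
theorem mulVec_minusState {G : Operator (Qubits n a b)} {f : (Fin n → Bit) → (Fin n → Bit) → Bit}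
    (hG : ∀ x y z, G *ᵥ ket (config x y z) = ket (config x y (z + f x y)))
    (x y : Fin n → Bit) :
    G *ᵥ minusState x y = sgn (f x y) • minusState x y := by
  simp only [minusState_eq, mulVec_sum, mulVec_smul, hG, Finset.smul_sum]
  refine Fintype.sum_equiv (Equiv.addRight fun _ => f x y) _ _ fun v => ?_
  rw [smul_smul]
  change _ = (_ * (_ * sgn (v () + f x y))) • ket (config x y (v () + f x y))
  rw [sgn_add]
  congr 1
  linear_combination (-((√2 : ℝ) : ℂ)⁻¹ * sgn (v ())) * sgn_mul_self (f x y)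

theorem hadamardOn_comm {ι κ κ' : Type} [Fintype ι] [DecidableEq ι] [Fintype κ] [Fintype κ']
    {f : κ ↪ ι} {g : κ' ↪ ι} (h : Disjoint (Set.range f) (Set.range g)) :
    hadamardOn f * hadamardOn g = hadamardOn g * hadamardOn f :=
  (isLocal_hadamardOn f).commute h (isLocal_hadamardOn g)

theorem disjoint_aliceInput_answerRegister :
    Disjoint (Set.range (aliceInput (n := n) (a := a) (b := b))) (Set.range answerRegister) := by
  simp [Set.disjoint_left]

theorem disjoint_bobInput_answerRegister :
    Disjoint (Set.range (bobInput (n := n) (a := a) (b := b))) (Set.range answerRegister) := by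
  simp [Set.disjoint_left]

theorem hadamardOn_aliceInput_minusState (x y : Fin n → Bit) :
    hadamardOn aliceInput *ᵥ minusState (a := a) (b := b) x y =
      ∑ v, (((√2 : ℝ) : ℂ)⁻¹ ^ n * sgn (IP n v x)) • minusState v y := by
  rw [minusState, mulVec_mulVec, hadamardOn_comm disjoint_aliceInput_answerRegister,
    ← mulVec_mulVec, hadamardOn_mulVec_ket, mulVec_sum]
  simp only [mulVec_smul, extend_aliceInput, Fintype.card_fin]
  rfl

theorem hadamardOn_bobInput_minusState (x y : Fin n → Bit) :
    hadamardOn bobInput *ᵥ minusState (a := a) (b := b) x y =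
      ∑ v, (((√2 : ℝ) : ℂ)⁻¹ ^ n * sgn (IP n v y)) • minusState x v := by
  rw [minusState, mulVec_mulVec, hadamardOn_comm disjoint_bobInput_answerRegister,
    ← mulVec_mulVec, hadamardOn_mulVec_ket, mulVec_sum]
  simp only [mulVec_smul, extend_bobInput, Fintype.card_fin]
  rfl

theorem IP_zero (x : Fin n → Bit) : IP n x 0 = 0 := by simp [IP]

theorem IP_comm (x y : Fin n → Bit) : IP n x y = IP n y x := by simp [IP, mul_comm]

variable {G : Operator (Qubits n a b)}

/-- A clean protocol for the inner product transmits `y` from Bob to Alice. -/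
theorem mulVec_hadamardOn_aliceInput
    (hG : ∀ x y z, G *ᵥ ket (config x y z) = ket (config x y (z + IP n x y))) (y : Fin n → Bit) :
    G *ᵥ (hadamardOn aliceInput *ᵥ minusState 0 y) = hadamardOn aliceInput *ᵥ minusState y y := by
  simp only [hadamardOn_aliceInput_minusState, mulVec_sum, mulVec_smul, mulVec_minusState hG,
    IP_zero, sgn_zero, mul_one, smul_smul]

/-- A clean protocol for the inner product transmits `x` from Alice to Bob. -/
theorem mulVec_hadamardOn_bobInput
    (hG : ∀ x y z, G *ᵥ ket (config x y z) = ket (config x y (z + IP n x y))) (x : Fin n → Bit) :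
    G *ᵥ (hadamardOn bobInput *ᵥ minusState x 0) = hadamardOn bobInput *ᵥ minusState x x := by
  simp only [hadamardOn_bobInput_minusState, mulVec_sum, mulVec_smul, mulVec_minusState hG,
    IP_zero, sgn_zero, mul_one, smul_smul]
  exact Finset.sum_congr rfl fun v _ => by rw [IP_comm x v]

theorem expect_readout_minusState {f : Fin n ↪ Qubits n a b}
    (hf : Disjoint (Set.range f) (Set.range answerRegister)) (x y : Fin n → Bit) :
    expect (readout f (config x y 1 ∘ f)) (minusState x y) = 1 := by
  rw [minusState, expect_mulVec_of_disjoint hf.symm (isLocal_readout _ _) (isLocal_hadamardOn _)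
    (hadamardOn_unitary _), expect_readout_ket]

theorem fresh_ket {ι X : Type} [Fintype ι] [DecidableEq ι] {T : Set ι} {w : X → ι → Bit}
    (u : ι → Bit) (h : ∀ x, ∀ i ∈ T, w x i = u i) : Fresh T fun x => ket (w x) := by
  refine ⟨1, u, fun x => ket (w x), isLocal_one T, by simp, fun x => (one_mulVec _).symm,
    fun x v hv => ?_, fun x => ?_⟩
  · have : v = w x := by
      by_contra h'
      exact hv (Pi.single_eq_of_ne h' _)
    exact this ▸ h x
  · rw [Finset.sum_eq_single (w x)]
    · simp [ket]
    · intro v _ hv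
      simp [ket, hv]
    · simp

/-- Bob's registers start in a product state independent of `x`, up to Hadamards that Bob can apply.
-/
theorem fresh_minusState_bob :
    Fresh (holdings (initialOwner n a b) .bob)
      fun x => hadamardOn bobInput *ᵥ minusState x 0 := by
  have hB : Set.range (bobInput (n := n) (a := a) (b := b)) ⊆
      holdings (initialOwner n a b) .bob := by
    rintro _ ⟨i, rfl⟩
    rfl
  have hans : Set.range (answerRegister (n := n) (a := a) (b := b)) ⊆
      holdings (initialOwner n a b) .bob := by
    rintro _ ⟨i, rfl⟩
    rfl
  refine Fresh.own (Fresh.own (fresh_ket (config 0 0 1) fun x i hi => ?_)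
    ((isLocal_hadamardOn _).mono hans) (hadamardOn_unitary _))
    ((isLocal_hadamardOn _).mono hB) (hadamardOn_unitary _)
  rcases i with ((i | i) | (i | i)) | i
  · cases hi
  all_goals rfl

theorem fresh_minusState_alice :
    Fresh (holdings (initialOwner n a b) .alice)
      fun y => hadamardOn aliceInput *ᵥ minusState 0 y := by
  have hA : Set.range (aliceInput (n := n) (a := a) (b := b)) ⊆
      holdings (initialOwner n a b) .alice := by
    rintro _ ⟨i, rfl⟩
    rfl
  have hans : Disjoint (Set.range (answerRegister (n := n) (a := a) (b := b)))
      (holdings (initialOwner n a b) .alice) := by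
    rw [Set.disjoint_left]
    rintro _ ⟨i, rfl⟩ h
    cases h
  refine Fresh.own (Fresh.other (fresh_ket (config 0 0 1) fun x i hi => ?_)
    hans (isLocal_hadamardOn _) (hadamardOn_unitary _))
    ((isLocal_hadamardOn _).mono hA) (hadamardOn_unitary _)
  rcases i with ((i | i) | (i | i)) | i
  · rfl
  · rfl
  all_goals cases hi

/-- Clean protocols for the inner product of `n`-bit strings exchange more than `n` qubits. -/
theorem Protocol.ComputesCleanly.lt_cost (hn : 1 ≤ n) {P : Protocol n a b}
    (hP : P.ComputesCleanly (IP n)) : n + 1 ≤ P.cost := by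
  obtain ⟨G, hG⟩ := P.turns.exists_run_eq
  have hG' : ∀ x y z, G *ᵥ ket (config x y z) = ket (config x y (z + IP n x y)) :=
    fun x y z => (hG _).symm.trans (hP.run_eq x y z)
  have hA := fresh_minusState_alice.run P.turns
  have hB := fresh_minusState_bob.run P.turns
  -- The final states are Hadamard transforms of `y` on Alice's side and of `x` on Bob's, in the
  -- form that `Bounded.two_pow_le` reads out.
  simp only [hG, mulVec_hadamardOn_aliceInput hG', mulVec_hadamardOn_bobInput hG'] at hA hB
  have hA' := hA.two_pow_le aliceInput (by rintro _ ⟨i, rfl⟩; exact hP.alice_input i)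
    fun y => expect_readout_minusState disjoint_aliceInput_answerRegister y y
  have hB' := hB.two_pow_le bobInput (by rintro _ ⟨i, rfl⟩; exact hP.bob_input i)
    fun x => expect_readout_minusState disjoint_bobInput_answerRegister x x
  rw [Fintype.card_fin, pow_le_pow_iff_right₀ (by norm_num)] at hA' hB'
  have := P.turns.gain_add_gain
  rw [Protocol.cost]
  omega

end LowerBound

/-! ### Composing turns, and phases from Paulis on a travelling qubit. -/

section Realizes
variable {ι : Type}

/-- The accumulated bits of a sequence of Pauli corrections. -/
def partialSum (γ : ℕ → (ι → Bit) → Bit) (i : ℕ) (w : ι → Bit) : Bit := ∑ j ∈ Finset.range i, γ j w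

theorem dependsOn_partialSum {T : Set ι} {γ : ℕ → (ι → Bit) → Bit} (h : ∀ i, DependsOn (γ i) T)
    (i : ℕ) : DependsOn (partialSum γ i) T :=
  fun _ _ hw => Finset.sum_congr rfl fun j _ => h j hw

variable [Fintype ι] [DecidableEq ι]

/-- Player `p`, acting first, and the other player can apply `G`, exchanging `c` qubits and passing
from the possession `o` to `o'`. -/
def Realizes (p : Player) (o : ι → Player) (G : Operator ι) (o' : ι → Player) (c : ℕ) : Prop :=
  ∃ t : Turns p o, (∀ ψ, t.run ψ = G *ᵥ ψ) ∧ t.finalOwner = o' ∧ t.cost = c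

theorem realizes_one (p : Player) (o : ι → Player) : Realizes p o 1 o 0 :=
  ⟨.done p o, fun ψ => (one_mulVec ψ).symm, rfl, rfl⟩

theorem Realizes.turn {p : Player} {o o' : ι → Player} {G G' : Operator ι} {c : ℕ} {S : Finset ι}
    (h : Realizes p.other (transfer o p S) G' o' c) (hG : IsLocal (holdings o p) G)
    (hU : Gᴴ * G = 1) (hS : ∀ i ∈ S, o i = p) : Realizes p o (G' * G) o' (S.card + c) := by
  obtain ⟨t, h1, h2, h3⟩ := h
  obtain ⟨U, rfl⟩ := exists_extend_eq hG hU
  exact ⟨.turn p o U S hS t, fun ψ => by rw [Turns.run, h1, applyLocal_eq, mulVec_mulVec],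
    h2, by rw [Turns.cost, h3]⟩

/-- A turn without communication. -/
theorem Realizes.localTurn {p : Player} {o o' : ι → Player} {G G' : Operator ι} {c : ℕ}
    (h : Realizes p.other o G' o' c) (hG : IsLocal (holdings o p) G)
    (hU : Gᴴ * G = 1) : Realizes p o (G' * G) o' c := by
  have := Realizes.turn (S := ∅) (by rwa [transfer_empty]) hG hU (by simp)
  rwa [Finset.card_empty, zero_add] at this

/-- Qubit `t` of Alice makes a round trip: Alice applies `A` and sends it to Bob, who applies `B`
and sends it back. -/
theorem Realizes.roundTrip {o o' : ι → Player} {t : ι} (ht : o t = .alice) {G A B : Operator ι}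
    {c : ℕ} (h : Realizes .alice o G o' c) (hA : IsLocal (holdings o .alice) A) (hA' : Aᴴ * A = 1)
    (hB : IsLocal (insert t (holdings o .bob)) B) (hB' : Bᴴ * B = 1) :
    Realizes .alice o (G * (B * A)) o' (c + 2) := by
  have back : transfer (transfer o .alice {t}) .bob {t} = o := by
    funext i
    by_cases hi : i = t
    · subst hi; simp [transfer, ht, Player.other]
    · simp [transfer, hi]
  rw [← mul_assoc, show c + 2 = 1 + (1 + c) by omega]
  refine Realizes.turn (S := {t}) (Realizes.turn (S := {t}) ?_ ?_ hB' ?_) hA hA' (by simpa using ht)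
  · exact back.symm ▸ h
  · have := holdings_transfer_other o .alice {t}
    rw [Player.other] at this ⊢
    rwa [this, Finset.coe_singleton, Set.union_singleton]
  · simp [transfer]

theorem Operator.ext_ket {A B : Operator ι} (h : ∀ w, A *ᵥ ket w = B *ᵥ ket w) : A = B := by
  ext w' w
  rw [← mulVec_ket A, h, mulVec_ket]

/-- Adds `b` to qubit `t` and multiplies by the phase `(-1)^g`. -/
def shiftOp (t : ι) (b g : (ι → Bit) → Bit) : Operator ι :=
  Matrix.of fun w' w => if w' = w + Pi.single t (b w) then sgn (g w) else 0

theorem shiftOp_mulVec_ket (t : ι) (b g : (ι → Bit) → Bit) (w : ι → Bit) :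
    shiftOp t b g *ᵥ ket w = sgn (g w) • ket (w + Pi.single t (b w)) := by
  funext w'
  rw [mulVec_ket]
  simp [shiftOp, ket, Pi.single_apply]

/-- As `b` ignores qubit `t`, the shift permutes the basis strings. -/
theorem shiftOp_unitary {t : ι} {b : (ι → Bit) → Bit} (g : (ι → Bit) → Bit)
    (hb : DependsOn b {i | i ≠ t}) : (shiftOp t b g)ᴴ * shiftOp t b g = 1 := by
  ext w w'
  simp only [mul_apply, conjTranspose_apply, shiftOp, of_apply, apply_ite star, star_sgn, star_zero,
    ite_mul, zero_mul, Finset.sum_ite_eq', Finset.mem_univ, if_true]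
  by_cases h : w = w'
  · subst h
    simp [sgn_mul_self]
  · rw [one_apply_ne h, if_neg, mul_zero]
    intro h'
    refine h ?_
    have : b w = b w' := hb fun i hi => by simpa [Pi.single_eq_of_ne hi] using congrFun h' i
    rwa [this, add_left_inj] at h'

theorem isLocal_shiftOp {T : Set ι} {t : ι} (ht : t ∈ T) {b g : (ι → Bit) → Bit}
    (hb : DependsOn b T) (hg : DependsOn g T) : IsLocal T (shiftOp t b g) := by
  refine ⟨fun w w' hw i hi => ?_, fun w w' v hv => ?_⟩
  · rw [shiftOp, of_apply] at hw
    split_ifs at hw with h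
    · have hit : i ≠ t := fun h => hi (h ▸ ht)
      simp [h, hit]
    · exact absurd rfl hw
  · have hv' : ∀ i ∈ T, (w' + v) i = w' i := fun i hi => by simp [hv i hi]
    rw [shiftOp, of_apply, of_apply, hb hv', hg hv', add_right_comm]
    simp only [add_left_inj]

/-- The phase accumulated in `i` rounds in which the Paulis of Alice have become
`Z^(α i) X^(β i)` and Bob has applied `X^(γ j) Z^(δ j)` for all `j < i`. -/
def roundPhase (t : ι) (α β γ δ : ℕ → (ι → Bit) → Bit) (i : ℕ) (w : ι → Bit) : Bit :=
  w t * partialSum δ i w + ∑ j ∈ Finset.range i, (α (j + 1) w * γ j w + β (j + 1) w * δ j w) +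
    α i w * (w t + partialSum γ i w)

/-- Qubit `t` of Alice makes `i` round trips; the Paulis of the players on it give rise to phases
that are the products of their exponents. -/
theorem Realizes.rounds {o o' : ι → Player} {t : ι} (ht : o t = .alice)
    {α β γ δ : ℕ → (ι → Bit) → Bit} (hα : ∀ i, DependsOn (α i) (holdings o .alice \ {t}))
    (hβ : ∀ i, DependsOn (β i) (holdings o .alice \ {t}))
    (hγ : ∀ i, DependsOn (γ i) (holdings o .bob)) (hδ : ∀ i, DependsOn (δ i) (holdings o .bob))
    (hα0 : α 0 = 0) (hβ0 : β 0 = 0) (i : ℕ) {G : Operator ι} {c : ℕ}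
    (h : Realizes .alice o G o' c) :
    Realizes .alice o
      (G * shiftOp t (partialSum γ i + β i) (roundPhase t α β γ δ i)) o' (c + 2 * i) := by
  induction i generalizing G c with
  | zero =>
    have : shiftOp t (partialSum γ 0 + β 0) (roundPhase t α β γ δ 0) = 1 :=
      Operator.ext_ket fun w => by
        simp [shiftOp_mulVec_ket, roundPhase, hα0, hβ0, partialSum]
    simpa [this] using h
  | succ i ih =>
    have hbob : t ∉ holdings o .bob := fun h => by
      rw [holdings, Set.mem_ofPred_eq, ht] at h
      cases h
    have hAt : holdings o .alice \ {t} ⊆ {i | i ≠ t} := fun i hi => hi.2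
    have hBt : holdings o .bob ⊆ {i | i ≠ t} := fun i hi h => hbob (h ▸ hi)
    have hΓ := dependsOn_partialSum hγ i
    -- Round `i + 1`, inserted between the first `i` rounds and `G`. `A` replaces Alice's
    -- accumulated X^(β i) Z^(α i), Z acting first, by that of index `i + 1`. In each phase the
    -- player's own accumulated shift is removed from qubit `t`, so only the other player's shift
    -- contributes.
    have hstep := Realizes.roundTrip ht
      (A := shiftOp t (β (i + 1) + β i) fun w => (α (i + 1) w + α i w) * (w t + β i w))
      (B := shiftOp t (γ i) fun w => δ i w * (w t + partialSum γ i w)) h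
      (isLocal_shiftOp (show t ∈ holdings o .alice from ht)
        (fun w w' hw => congrArg₂ (· + ·) (hβ _ fun i hi => hw i hi.1) (hβ _ fun i hi => hw i hi.1))
        (fun w w' hw => by
          have hw' : ∀ i ∈ holdings o .alice \ {t}, w i = w' i := fun i hi => hw i hi.1
          rw [hα (i + 1) hw', hα i hw', hβ i hw', hw t ht]))
      (shiftOp_unitary _ fun w w' hw => congrArg₂ (· + ·) (hβ _ fun i hi => hw i (hAt hi))
        (hβ _ fun i hi => hw i (hAt hi)))
      (isLocal_shiftOp (Set.mem_insert _ _) (fun w w' hw => hγ i fun j hj => hw j (.inr hj))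
        (fun w w' hw => by
          have hw' : ∀ i ∈ holdings o .bob, w i = w' i := fun i hi => hw i (.inr hi)
          rw [hδ i hw', hΓ hw', hw t (.inl rfl)]))
      (shiftOp_unitary _ fun w w' hw => hγ i fun j hj => hw j (hBt hj))
    have key := ih hstep
    rw [mul_assoc] at key
    rw [show c + 2 + 2 * i = c + 2 * (i + 1) by omega] at key
    refine (congrArg (fun M => Realizes .alice o (G * M) o' _)
      (Operator.ext_ket fun w => ?_)).mpr key
    have inv : ∀ {T : Set ι} {f : (ι → Bit) → Bit} (_ : DependsOn f T) (_ : T ⊆ {i | i ≠ t})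
        (w : ι → Bit) (b : Bit), f (w + Pi.single t b) = f w := fun hf hT w b =>
      hf fun i hi => by simp [Pi.single_eq_of_ne (hT hi)]
    have h2 : (2 : Bit) = 0 := rfl
    rw [← mulVec_mulVec, ← mulVec_mulVec, shiftOp_mulVec_ket, shiftOp_mulVec_ket, mulVec_smul,
      shiftOp_mulVec_ket, mulVec_smul, mulVec_smul, shiftOp_mulVec_ket, smul_smul, smul_smul,
      ← sgn_add, ← sgn_add]
    simp only [Pi.add_apply, inv (hα _) hAt, inv (hβ _) hAt, inv (hγ _) hBt, inv (hδ _) hBt,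
      inv hΓ hBt, Pi.single_eq_same, add_assoc w, ← Pi.single_add, roundPhase]
    simp only [partialSum, Finset.sum_range_succ]
    congr 2
    -- Summation by parts for Alice's phases; the discrepancy consists of terms occurring twice,
    -- which vanish modulo 2.
    · linear_combination (-(α i w * w t + α i w * ∑ j ∈ Finset.range i, γ j w + α (i + 1) w * β i w
        + α i w * β i w + δ i w * ∑ j ∈ Finset.range i, γ j w + δ i w * β i w
        - α (i + 1) w * γ i w)) * h2
    · congr 2
      linear_combination (-β i w) * h2

end Realizes

/-! ### The protocol without ancilla qubits. -/

section UpperBound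
variable {n : ℕ}

/-- Bit `j` of Alice's input, where bit `0` is replaced by `0`. -/
def aliceBit (n j : ℕ) (w : Qubits n 0 0 → Bit) : Bit :=
  if h : j < n then if j = 0 then 0 else w (aliceInput ⟨j, h⟩) else 0

/-- The product of bit `j` of Bob's input and the answer register. -/
def bobBit (n j : ℕ) (w : Qubits n 0 0 → Bit) : Bit :=
  if h : j < n then w (.inr ()) * w (bobInput ⟨j, h⟩) else 0

/-- Bit 0 is excluded because its qubit is the one that travels. -/
theorem dependsOn_aliceBit (hn : 0 < n) (j : ℕ) :
    DependsOn (aliceBit n j)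
      (holdings (initialOwner n 0 0) .alice \ {aliceInput ⟨0, hn⟩}) := by
  intro w w' hw
  rw [aliceBit, aliceBit]
  split_ifs with h h0
  · rfl
  · exact hw _ ⟨rfl, by simp [h0]⟩
  · rfl

theorem dependsOn_bobBit (j : ℕ) :
    DependsOn (bobBit n j) (holdings (initialOwner n 0 0) .bob) := by
  intro w w' hw
  rw [bobBit, bobBit]
  split_ifs with h
  · rw [hw (.inr ()) rfl, hw (bobInput ⟨j, h⟩) rfl]
  · rfl

/-- Bob's corrections `c 0, …, c (k - 1)`, followed by their sum. -/
def withTotal (k : ℕ) (c : ℕ → (Qubits n 0 0 → Bit) → Bit) (j : ℕ) : (Qubits n 0 0 → Bit) → Bit :=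
  if j < k then c j else partialSum c k

theorem dependsOn_withTotal {T : Set (Qubits n 0 0)} {c : ℕ → (Qubits n 0 0 → Bit) → Bit}
    (h : ∀ j, DependsOn (c j) T) (k j : ℕ) : DependsOn (withTotal k c j) T := by
  rw [withTotal]
  split_ifs
  exacts [h j, dependsOn_partialSum h k]

theorem partialSum_withTotal (k : ℕ) (c : ℕ → (Qubits n 0 0 → Bit) → Bit)
    (w : Qubits n 0 0 → Bit) : partialSum (withTotal k c) (k + 1) w = 0 := by
  rw [partialSum, Finset.sum_range_succ, Finset.sum_congr rfl fun j hj => by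
    rw [withTotal, if_pos (Finset.mem_range.1 hj)], withTotal, if_neg (lt_irrefl k)]
  exact CharTwo.add_self_eq_zero _

theorem sum_range_two_mul {M : Type} [AddCommMonoid M] (f : ℕ → M) (k : ℕ) :
    ∑ j ∈ Finset.range k, (f (2 * j + 1) + f (2 * j)) = ∑ j ∈ Finset.range (2 * k), f j := by
  induction k with
  | zero => rfl
  | succ k ih =>
    rw [Finset.sum_range_succ, ih, mul_add, mul_one, Finset.sum_range_succ, Finset.sum_range_succ,
      add_assoc, add_comm (f (2 * k))]

/-- The phase `(-1)^(z IP(x, y))`. -/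
def phaseIP (n : ℕ) (w : Qubits n 0 0 → Bit) : Bit :=
  w (.inr ()) * IP n (w ∘ aliceInput) (w ∘ bobInput)

/-- Without ancilla qubits, the phase `(-1)^(z IP(x, y))` can be applied by sending the first qubit
of Alice back and forth. -/
theorem realizes_phaseIP (hn : 0 < n) {k : ℕ} (hk : n ≤ 2 * k) {G : Operator (Qubits n 0 0)}
    {o' : Qubits n 0 0 → Player} {c : ℕ} (h : Realizes .alice (initialOwner n 0 0) G o' c) :
    Realizes .alice (initialOwner n 0 0) (G * shiftOp (aliceInput ⟨0, hn⟩) 0 (phaseIP n)) o'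
      (c + 2 * (k + 1)) := by
  set t : Qubits n 0 0 := aliceInput ⟨0, hn⟩ with ht
  -- Round `j + 1` handles bits `2 * j + 1` (Alice's Z, Bob's X) and `2 * j` (Alice's X, Bob's Z).
  -- At `i = 0` the truncated subtractions give index 0, where `aliceBit` vanishes, as
  -- `Realizes.rounds` needs.
  set α : ℕ → (Qubits n 0 0 → Bit) → Bit := fun i => aliceBit n (2 * i - 1)
  set β : ℕ → (Qubits n 0 0 → Bit) → Bit := fun i => aliceBit n (2 * i - 2)
  set γ := withTotal (n := n) k fun j => bobBit n (2 * j + 1)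
  -- In the last round Bob cancels the earlier Z's but adds one with exponent `bobBit n 0`; acting
  -- on the travelling qubit, it yields the missing term of IP for bit 0.
  set δ : ℕ → (Qubits n 0 0 → Bit) → Bit := fun j w =>
    withTotal (n := n) k (fun j => bobBit n (2 * j)) j w + if j = k then bobBit n 0 w else 0
  have hδ : ∀ j, DependsOn (δ j) (holdings (initialOwner n 0 0) .bob) := by
    intro j w w' hw
    simp only [δ]
    rw [dependsOn_withTotal (fun j => dependsOn_bobBit _) k j hw, dependsOn_bobBit 0 hw]
  have key := Realizes.rounds (t := t) rfl (α := α) (β := β) (γ := γ) (δ := δ)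
    (fun i => dependsOn_aliceBit hn _) (fun i => dependsOn_aliceBit hn _)
    (dependsOn_withTotal (fun j => dependsOn_bobBit _) k) hδ
    (by funext w; simp [α, aliceBit]) (by funext w; simp [β, aliceBit]) (k + 1) h
  -- In the last round both of Alice's indices are at least `n`, so Alice's Paulis are undone there.
  have hα : α (k + 1) = 0 := by
    funext w
    simp only [α, aliceBit]
    rw [dif_neg (by omega)]; rfl
  have hβ : β (k + 1) = 0 := by
    funext w
    simp only [β, aliceBit]
    rw [dif_neg (by omega)]; rfl
  have e1 : partialSum γ (k + 1) + β (k + 1) = 0 := by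
    funext w
    simp [γ, partialSum_withTotal, hβ]
  have e2 : roundPhase t α β γ δ (k + 1) = phaseIP n := by
    funext w
    have hΔ : partialSum δ (k + 1) w = bobBit n 0 w := by
      have := partialSum_withTotal k (fun j => bobBit n (2 * j)) w
      rw [partialSum] at this ⊢
      simp only [δ]
      rw [Finset.sum_add_distrib, this]
      simp
    have hsum : ∑ j ∈ Finset.range (k + 1), (α (j + 1) w * γ j w + β (j + 1) w * δ j w) =
        ∑ j ∈ Finset.range n, aliceBit n j w * bobBit n j w := by
      rw [Finset.sum_range_succ, hα, hβ, Pi.zero_apply, zero_mul, zero_mul, add_zero, add_zero,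
        Finset.sum_subset (Finset.range_subset_range.2 hk), ← sum_range_two_mul]
      · refine Finset.sum_congr rfl fun j hj => ?_
        have hj' := Finset.mem_range.1 hj
        simp only [α, β, γ, δ, withTotal, if_pos hj', if_neg hj'.ne, add_zero]
        rw [show 2 * (j + 1) - 1 = 2 * j + 1 by omega, show 2 * (j + 1) - 2 = 2 * j by omega]
      · intro j _ hj
        rw [aliceBit, dif_neg fun h => hj (Finset.mem_range.2 h), zero_mul]
    rw [roundPhase, hΔ, hsum, hα, Pi.zero_apply, zero_mul, add_zero, phaseIP, IP, Finset.mul_sum,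
      Finset.sum_range]
    obtain ⟨m, rfl⟩ := Nat.exists_eq_succ_of_ne_zero hn.ne'
    rw [Fin.sum_univ_succ, Fin.sum_univ_succ, ← add_assoc]
    congr 1
    · simp [aliceBit, bobBit, ht]
      ring
    · refine Finset.sum_congr rfl fun j _ => ?_
      have hj : (j : ℕ) + 1 < m + 1 := by omega
      simp only [aliceBit, bobBit, Fin.val_succ, dif_pos hj, Function.comp_apply]
      rw [if_neg (by omega)]
      change w (aliceInput j.succ) * (_ * w (bobInput j.succ)) = _
      ring
  rwa [e1, e2] at key

/-- The Hadamard operator on the answer register turns the phase into an addition. -/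
theorem hadamardOn_phaseIP (hn : 0 < n) (x y : Fin n → Bit) (z : Bit) :
    (hadamardOn answerRegister * (shiftOp (aliceInput ⟨0, hn⟩) 0 (phaseIP n) *
      hadamardOn answerRegister)) *ᵥ ket (config (a := 0) (b := 0) x y z) =
      ket (config x y (z + IP n x y)) := by
  have h : shiftOp (aliceInput ⟨0, hn⟩) 0 (phaseIP n) *ᵥ
      (hadamardOn answerRegister *ᵥ ket (config (a := 0) (b := 0) x y z)) =
      hadamardOn answerRegister *ᵥ ket (config x y (z + IP n x y)) := by
    simp only [hadamardOn_mulVec_ket, mulVec_sum, mulVec_smul, shiftOp_mulVec_ket, smul_smul,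
      extend_answerRegister, Pi.zero_apply, Pi.single_zero, add_zero]
    refine Finset.sum_congr rfl fun v _ => ?_
    congr 1
    rw [mul_assoc, ← sgn_add]
    congr 2
    simp only [Finset.univ_unique, Finset.sum_singleton, answerRegister_apply]
    change v () * z + v () * IP n x y = v () * (z + IP n x y)
    ring
  rw [← mulVec_mulVec, ← mulVec_mulVec, h, mulVec_mulVec, hadamardOn_mul_self, one_mulVec]

/-- A clean protocol without ancilla qubits for the inner product. -/
theorem exists_protocol_IP (hn : 0 < n) {k : ℕ} (hk : n ≤ 2 * k) :
    ∃ P : Protocol n 0 0, P.ComputesCleanly (IP n) ∧ P.cost = 2 * k + 2 := by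
  have hl : IsLocal (holdings (initialOwner n 0 0) .bob) (hadamardOn answerRegister) :=
    (isLocal_hadamardOn _).mono (by rintro _ ⟨i, rfl⟩; rfl)
  have hu := hadamardOn_unitary (answerRegister (n := n) (a := 0) (b := 0))
  -- Turns alternate, so Alice idles once before Bob's final Hadamard.
  have last : Realizes .alice (initialOwner n 0 0) (hadamardOn answerRegister)
      (initialOwner n 0 0) 0 := by
    have := ((realizes_one .alice (initialOwner n 0 0)).localTurn (p := .bob) hl hu).localTurn
      (p := .alice) (isLocal_one _) (by simp)
    rwa [one_mul, mul_one] at this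
  obtain ⟨T, h1, h2, h3⟩ := (realizes_phaseIP hn hk last).localTurn (p := .bob) hl hu
  refine ⟨⟨.bob, T⟩, ⟨fun x y z => ?_, fun i => ?_, fun i => ?_, ?_⟩, ?_⟩
  · rw [h1, mul_assoc, hadamardOn_phaseIP]
  · rw [h2]; rfl
  · rw [h2]; rfl
  · rw [h2]; rfl
  · rw [Protocol.cost, h3]; ring

end UpperBound

theorem Qclean_le {n a b : ℕ} {f : (Fin n → Bit) → (Fin n → Bit) → Bit} {P : Protocol n a b}
    (hP : P.ComputesCleanly f) : Qclean f ≤ P.cost :=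
  iInf_le_of_le a <| iInf_le_of_le b <| iInf_le_of_le P <| iInf_le _ hP

end CleanComm

theorem theorem1 (n : ℕ) (hn : 1 ≤ n) :
    ((n + 1 : ℕ) : ℕ∞) ≤ CleanComm.Qclean (CleanComm.IP n) ∧
    (Odd n → CleanComm.Qclean (CleanComm.IP n) ≤ ((n + 3 : ℕ) : ℕ∞)) ∧
    (Even n → CleanComm.Qclean (CleanComm.IP n) ≤ ((n + 2 : ℕ) : ℕ∞)) ∧
    (Odd n → ∃ P : CleanComm.Protocol n 0 0,
      P.ComputesCleanly (CleanComm.IP n) ∧ P.cost ≤ n + 3) ∧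
    (Even n → ∃ P : CleanComm.Protocol n 0 0,
      P.ComputesCleanly (CleanComm.IP n) ∧ P.cost ≤ n + 2) := by
  have hodd : Odd n → ∃ P : CleanComm.Protocol n 0 0,
      P.ComputesCleanly (CleanComm.IP n) ∧ P.cost ≤ n + 3 := by
    rintro ⟨k, hk⟩
    -- Two bits per round need n/2 rounds, rounded up; the rounding costs the extra qubit for odd
    -- `n`.
    obtain ⟨P, hP, hc⟩ := CleanComm.exists_protocol_IP hn (k := k + 1) (by omega)
    exact ⟨P, hP, by omega⟩
  have heven : Even n → ∃ P : CleanComm.Protocol n 0 0,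
      P.ComputesCleanly (CleanComm.IP n) ∧ P.cost ≤ n + 2 := by
    rintro ⟨k, hk⟩
    obtain ⟨P, hP, hc⟩ := CleanComm.exists_protocol_IP hn (k := k) (by omega)
    exact ⟨P, hP, by omega⟩
  refine ⟨?_, fun h => ?_, fun h => ?_, hodd, heven⟩
  · refine le_iInf fun a => le_iInf fun b => le_iInf fun P => le_iInf fun hP => ?_
    exact_mod_cast hP.lt_cost hn
  · obtain ⟨P, hP, hc⟩ := hodd h
    exact (CleanComm.Qclean_le hP).trans (by exact_mod_cast hc)
  · obtain ⟨P, hP, hc⟩ := heven h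
    exact (CleanComm.Qclean_le hP).trans (by exact_mod_cast hc)
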